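/- Let $G$ be a finite connected undirected plane graph with positive edge capacities (capacities $1$ in the unweighted case), let $s\neq t$ be two vertices of $G$, and let $MF$ be the value of a maximum flow from $s$ to $t$. Let $G^*$ be the dual graph, where the length of a dual edge is the capacity of the edge it crosses; fix a face of $G$ adjacent to $s$, a face of $G$ adjacent to $t$, and a shortest path $\pi$ in $G^*$ from the first to the second. Let $D$ be the plane graph obtained from $G^*$ by cutting it along $\pi$, extended by dummy edges into the face $s$ and into the face $t$ of $G^*$: every vertex $f$ of $\pi$ is split into a lower copy $f_\ell$ and an upper copy $f_u$, and $\pi$ is doubled into a lower copy $\pi_x$ and an upper copy $\pi_y$, both on the outer face of $D$. Let $(x_1,y_1),\dots,(x_k,y_k)$ be all the pairs $(f_\ell,f_u)$ whose distance in $D$ is $MF$, in the order in which they appear along $\pi$. For each $i\in[k]$ let $p_i$ be a shortest $x_iy_i$-path in $D$, and suppose that for $i\neq j$ the intersection $p_i\cap p_j$ (of the vertex sets and of the edge sets) is a possibly empty path. Put $U=\bigcup_{i\in[k]}p_i$. Let $\ell_x,r_x$ be the first and the last vertex of $\pi_x$, and $\ell_y,r_y$ those of $\pi_y$. Let $\mathrm{Left}_i$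 be the subgraph of $D$ bounded by the closed walk formed by $\pi_y[\ell_y,y_i]$, $p_i$, $\pi_x[x_i,\ell_x]$ and the part of the boundary of the outer face of $D$ between $\ell_x$ and $\ell_y$ that comes from the face $s$ of $G^*$; let $\mathrm{Right}_i$ be the subgraph of $D$ bounded by the closed walk formed by $\pi_y[y_i,r_y]$, the part of the boundary of the outer face between $r_y$ and $r_x$ that comes from the face $t$ of $G^*$, $\pi_x[r_x,x_i]$ and $p_i$ (bounding walks are included). The slices are $\Omega_i=\mathrm{Right}_{i-1}\cap\mathrm{Left}_{i+1}$ for $1<i<k$, $\Omega_1=\mathrm{Left}_2$ and $\Omega_k=\mathrm{Right}_{k-1}$. Then for all $i,j\in[k]$ with $i+2\le j$ and every edge $e$ of $D$, $$e\in\Omega_i\cap\Omega_j\iff e\in p_z\text{ for all } z\in[k] \text{ with } i<z<j .$$ Consequently, every edge of $D$ that belongs to more than two of the slices $\Omega_1,\dots,\Omega_k$ belongs to $U$. -/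

import Mathlib

/-- A finite graph (loops and parallel edges allowed) embedded in a closed oriented surface, given by
its rotation system. A dart is an edge together with a direction, `α d` is the reverse of the dart `d`,
and `σ d` is the dart that follows `d` in the counterclockwise order around the tail of `d`. -/
structure EmbGraph (δ : Type*) where
  σ : Equiv.Perm δ
  α : Equiv.Perm δ
  α_α : ∀ d, α (α d) = d
  α_ne : ∀ d, α d ≠ d

namespace EmbGraph

variable {δ : Type*} (M : EmbGraph δ)

/-- `φ d` follows `d` on the boundary walk of the face on the left of `d`. -/
def φ : Equiv.Perm δ := M.σ⁻¹ * M.α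

/-- Vertices, edges and faces are the orbits of `σ`, `α` and `φ` respectively. -/
def Vertex : Type _ := Quotient (Equiv.Perm.SameCycle.setoid M.σ)

/-- Orbits of darts, see `Vertex`. -/
def Edge : Type _ := Quotient (Equiv.Perm.SameCycle.setoid M.α)

/-- Orbits of darts, see `Vertex`. -/
def Face : Type _ := Quotient (Equiv.Perm.SameCycle.setoid M.φ)

/-- The tail of a dart. -/
def tail (d : δ) : M.Vertex := Quotient.mk _ d

/-- The head of a dart. -/
def head (d : δ) : M.Vertex := M.tail (M.α d)

/-- The edge underlying a dart. -/
def edge (d : δ) : M.Edge := Quotient.mk _ d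

/-- The face on the left of a dart. -/
def face (d : δ) : M.Face := Quotient.mk _ d

/-- The dual embedded graph. Its darts are the darts of `M`; the dual of `d` crosses `d` from the face on
its left to the face on its right. Hence the tail of a dual dart is the face on the left of `d`,
the rotation at this face is its boundary walk, and the face of the dual on the left of the dual
dart is the head of `d`. -/
def dual : EmbGraph δ where
  σ := M.φ
  α := M.α
  α_α := M.α_α
  α_ne := M.α_ne

/-- `M.IsWalk u p v`: the list of darts `p` is a walk from `u` to `v`. -/
def IsWalk (u : M.Vertex) : List δ → M.Vertex → Prop
  | [], v => u = v
  | d :: p, v => M.tail d = u ∧ IsWalk (M.head d) p v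

/-- The vertices of a walk `p` starting at `u`, in order. -/
def support (u : M.Vertex) (p : List δ) : List M.Vertex := u :: p.map M.head

/-- The edge set of a walk. -/
def edges (p : List δ) : Set M.Edge := {e | ∃ d ∈ p, M.edge d = e}

/-- A (simple) path from `u` to `v`. -/
def IsPath (u : M.Vertex) (p : List δ) (v : M.Vertex) : Prop :=
  M.IsWalk u p v ∧ (M.support u p).Nodup

/-- The set of the lengths of all walks from `u` to `v`, where `w` gives the lengths of the edges. -/
def walkLengths (w : δ → ℝ) (u v : M.Vertex) : Set ℝ :=
  {r | ∃ p, M.IsWalk u p v ∧ r = (p.map w).sum}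

/-- The distance from `u` to `v` exists and is `r`. -/
def HasDist (w : δ → ℝ) (u v : M.Vertex) (r : ℝ) : Prop :=
  IsLeast (M.walkLengths w u v) r

/-- A shortest path from `u` to `v`. -/
def IsShortestPath (w : δ → ℝ) (u : M.Vertex) (p : List δ) (v : M.Vertex) : Prop :=
  M.IsPath u p v ∧ M.HasDist w u v (p.map w).sum

/-- The intersection (of the vertex sets and of the edge sets) of the path `p` from `u` and the path `q`
from `v` is a possibly empty path. -/
def SingleTouch (u : M.Vertex) (p : List δ) (v : M.Vertex) (q : List δ) : Prop :=
  (∀ z ∈ M.support u p, z ∉ M.support v q) ∨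
  ∃ a r b, M.IsPath a r b ∧
    (∀ z, z ∈ M.support a r ↔ z ∈ M.support u p ∧ z ∈ M.support v q) ∧
    M.edges r = M.edges p ∩ M.edges q

/-- The graph is connected and the surface in which it is embedded is the sphere
(Euler's formula). -/
def IsPlanar : Prop :=
  (∀ u v, ∃ p, M.IsWalk u p v) ∧
  Nat.card M.Vertex + Nat.card M.Face = Nat.card M.Edge + 2

/-- The part of the boundary walk of the face on the left of `a` that starts with the dart `a` and ends
just before the dart `b`. -/
def faceArc (a b : δ) : Set δ :=
  {d | ∃ n : ℕ, d = (M.φ ^ n) a ∧ ∀ m ≤ n, (M.φ ^ m) a ≠ b}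

/-- `f` is joined to the outer face `o` by a curve that does not meet the edges in `C` (nor any vertex):
`f` is not enclosed by `C`. -/
def IsExterior (o : M.Face) (C : Set M.Edge) (f : M.Face) : Prop :=
  Relation.ReflTransGen
    (fun g h => ∃ d, M.face d = g ∧ M.face (M.α d) = h ∧ M.edge d ∉ C) o f

/-- The edges of the subgraph bounded by a closed walk with edge set `C`, if `o` is the outer face:
those on the closed walk and those incident with a face enclosed by it. -/
def boundedEdges (o : M.Face) (C : Set M.Edge) : Set M.Edge :=
  {e | e ∈ C ∨ ∃ d, M.edge d = e ∧ ¬ M.IsExterior o C (M.face d)}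

/-- `x` is a feasible flow for the capacities `c`: `x d` is the amount sent along the edge of `d`
in the direction of `d`. -/
def IsFlow [Fintype δ] (c : δ → ℝ) (s t : M.Vertex) (x : δ → ℝ) : Prop :=
  open Classical in
  (∀ d, 0 ≤ x d ∧ x d ≤ c d) ∧
  ∀ v, v ≠ s → v ≠ t → ∑ d with M.tail d = v, x d = ∑ d with M.tail d = v, x (M.α d)

/-- The amount of flow from `s`. -/
noncomputable def flowValue [Fintype δ] (s : M.Vertex) (x : δ → ℝ) : ℝ :=
  open Classical in
  ∑ d with M.tail d = s, x d - ∑ d with M.tail d = s, x (M.α d)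

/-- The maximum flow from `s` to `t`. -/
noncomputable def maxFlow [Fintype δ] (c : δ → ℝ) (s t : M.Vertex) : ℝ :=
  sSup {r | ∃ x, M.IsFlow c s t x ∧ r = M.flowValue s x}

/-! ### Cutting an embedded graph along a path

Let `P = d₀ d₁ … d₍ₘ₋₁₎` be a path through the vertices `v₀, …, vₘ`. The path is extended by two dummy
edges, one ending at `v₀` in the corner between `a` and `σ a`, one starting at `vₘ` in the corner
between `b` and `σ b`. The graph is cut along `P`: each `vⱼ` is split into an upper vertex, which gets
the edges on the left of the extended path, and a lower vertex, which gets the edges on its right; the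
edges of `P` are doubled. The darts of the new graph are the old darts `inl d`, where those on `P`
now stand for the upper copies, and the lower copies `inr (j, false)` of `dⱼ` and
`inr (j, true)` of `α dⱼ`. -/

section cut

variable (P : List δ) (a b : δ)

/-- The dart at the upper copy of `vⱼ` after which the rotation passes through the slit: the upper copy
of `α d₍ⱼ₋₁₎`, and `a` for `j = 0`. The slit is on the left of this dart, next to its tail. -/
def upperDart : Fin (P.length + 1) → δ ⊕ Fin P.length × Bool :=
  Fin.cases (Sum.inl a) (fun j => Sum.inl (M.α P[j]))

variable [DecidableEq δ]

/-- The rotation after doubling the edges of `P` (before splitting vertices): the lower copy of `dⱼ` is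
inserted just before `dⱼ`, and the lower copy of `α dⱼ` just after `α dⱼ`. -/
def doubledRotation : Equiv.Perm (δ ⊕ Fin P.length × Bool) :=
  ((List.finRange P.length).map
    (fun j => Equiv.swap (Sum.inr (j, false)) (Sum.inl P[j]))).prod *
  Equiv.sumCongr M.σ (Equiv.refl _) *
  ((List.finRange P.length).map
    (fun j => Equiv.swap (Sum.inr (j, true)) (Sum.inl (M.α P[j])))).prod

/-- The dart at the lower copy of `vⱼ` after which the rotation passes through the slit: the lower copy
of `dⱼ`, and for `j = m` the dart just before `σ b` in the doubled graph (this is `b`, or the lower copy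
of `b` if `b = α d₍ₘ₋₁₎`). -/
def lowerDart : Fin (P.length + 1) → δ ⊕ Fin P.length × Bool :=
  Fin.lastCases ((M.doubledRotation P)⁻¹ (Sum.inl (M.σ b))) (fun j => Sum.inr (j, false))

/-- The graph cut along `P`: the rotation at `vⱼ` is split into two cycles, one ending with the upper
dart and one ending with the lower dart of `vⱼ`. -/
def cut : EmbGraph (δ ⊕ Fin P.length × Bool) where
  σ := M.doubledRotation P *
    ((List.finRange (P.length + 1)).map
      (fun j => Equiv.swap (M.upperDart P a j) (M.lowerDart P b j))).prod
  α := Equiv.sumCongr M.α (Equiv.prodCongr (Equiv.refl _) Equiv.boolNot)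
  α_α := by rintro (d | ⟨j, c⟩) <;> simp [M.α_α]
  α_ne := by rintro (d | ⟨j, c⟩) <;> simp [M.α_ne]

end cut

end EmbGraph

/-- A connected plane graph `G` with positive edge capacities `c`, two distinct vertices `s` and `t`, a face
adjacent to `s` (the one on the left of the dart `a` with head `s`), a face adjacent to `t` (the
one on the left of the dart `b` with head `t`), and a shortest path `P` in the dual graph between
these two faces, where a dual edge is as long as the capacity of its edge. -/
structure CutSetting (δ : Type*) where
  G : EmbGraph δ
  planar : G.IsPlanar
  c : δ → ℝ
  c_pos : ∀ d, 0 < c d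
  c_symm : ∀ d, c (G.α d) = c d
  s : G.Vertex
  t : G.Vertex
  s_ne_t : s ≠ t
  a : δ
  head_a : G.head a = s
  b : δ
  head_b : G.head b = t
  P : List δ
  shortest : G.dual.IsShortestPath c (G.dual.tail a) P (G.dual.tail b)

namespace CutSetting

variable {δ : Type*} [DecidableEq δ] (S : CutSetting δ)

/-- The darts of the doubled dual graph. -/
abbrev DDart : Type _ := δ ⊕ Fin S.P.length × Bool

/-- The doubled dual graph: the dual graph cut along `P`, from the face `s` of the dual to its face `t`
(in the corner after `a` lies the head `s` of `a`, and in that after `b` the head `t` of `b`). -/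
def D : EmbGraph S.DDart := S.G.dual.cut S.P S.a S.b

/-- The edge lengths in `D`. -/
def w : S.DDart → ℝ := Sum.elim S.c (fun j => S.c S.P[j.1])

/-- The outer face of `D`, into which the slit and the faces `s` and `t` of the dual are merged. -/
def outer : S.D.Face := S.D.face (S.G.dual.upperDart S.P S.a 0)

/-- The lower copy in `D` of the `j`-th vertex of `P`. -/
def lower (j : Fin (S.P.length + 1)) : S.D.Vertex :=
  S.D.tail (S.G.dual.lowerDart S.P S.b j)

/-- The upper copy in `D` of the `j`-th vertex of `P`. -/
def upper (j : Fin (S.P.length + 1)) : S.D.Vertex :=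
  S.D.tail (S.G.dual.upperDart S.P S.a j)

variable [Fintype δ]

open Classical in
/-- The positions `j` on `P` such that the distance in `D` between the two copies of the `j`-th vertex is
the value of the maximum flow. -/
noncomputable def positions : Finset (Fin (S.P.length + 1)) :=
  {j | S.D.HasDist S.w (S.lower j) (S.upper j) (S.G.maxFlow S.c S.s S.t)}

/-- The number of these positions. -/
noncomputable def k : ℕ := S.positions.card

/-- The `i`-th of these positions, in increasing order. -/
noncomputable def pos (i : Fin S.k) : Fin (S.P.length + 1) := S.positions.orderEmbOfFin rfl i

noncomputable def x (i : Fin S.k) : S.D.Vertex := S.lower (S.pos i)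

noncomputable def y (i : Fin S.k) : S.D.Vertex := S.upper (S.pos i)

/-- The edges of `D` on the lower copy of `P` between the vertices at positions `j₁` and `j₂`. -/
def lowerEdges (j₁ j₂ : Fin (S.P.length + 1)) : Set S.D.Edge :=
  {e | ∃ j : Fin S.P.length, j₁ ≤ j.castSucc ∧ j.succ ≤ j₂ ∧ S.D.edge (Sum.inr (j, false)) = e}

/-- The edges of `D` on the upper copy of `P` between the vertices at positions `j₁` and `j₂`. -/
def upperEdges (j₁ j₂ : Fin (S.P.length + 1)) : Set S.D.Edge :=
  {e | ∃ j : Fin S.P.length, j₁ ≤ j.castSucc ∧ j.succ ≤ j₂ ∧ S.D.edge (Sum.inl S.P[j]) = e}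

/-- The edges on the left side of the boundary of `D`: the boundary walk of the outer face between
the first vertices of the two copies of `P`. -/
def leftmostEdges : Set S.D.Edge :=
  S.D.edge '' S.D.faceArc (S.G.dual.upperDart S.P S.a 0) (S.G.dual.lowerDart S.P S.b 0)

/-- The edges on the right side of the boundary of `D`: the boundary walk of the outer face between the
last vertices of the two copies of `P`. -/
def rightmostEdges : Set S.D.Edge :=
  S.D.edge '' S.D.faceArc (S.G.dual.lowerDart S.P S.b (Fin.last _))
    (S.G.dual.upperDart S.P S.a (Fin.last _))

/-- `p` is a family of shortest `xᵢyᵢ`-paths, one for each `i`, that are pairwise single-touch. -/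
def IsPathFamily (p : Fin S.k → List S.DDart) : Prop :=
  (∀ i, S.D.IsShortestPath S.w (S.x i) (p i) (S.y i)) ∧
  ∀ i j, i ≠ j → S.D.SingleTouch (S.x i) (p i) (S.x j) (p j)

variable (p : Fin S.k → List S.DDart)

/-- The edges of the subgraph of `D` on the left of `p i` (including `p i`). -/
def Left (i : Fin S.k) : Set S.D.Edge :=
  S.D.boundedEdges S.outer
    (S.upperEdges 0 (S.pos i) ∪ S.D.edges (p i) ∪ S.lowerEdges 0 (S.pos i) ∪ S.leftmostEdges)

/-- The edges of the subgraph of `D` on the right of `p i` (including `p i`). -/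
def Right (i : Fin S.k) : Set S.D.Edge :=
  S.D.boundedEdges S.outer
    (S.upperEdges (S.pos i) (Fin.last _) ∪ S.rightmostEdges ∪
      S.lowerEdges (S.pos i) (Fin.last _) ∪ S.D.edges (p i))

/-- The edges of the `i`-th slice: those on the right of the previous path (if there is one) and on the
left of the next one (if there is one). -/
def Slice (i : Fin S.k) : Set S.D.Edge :=
  {e | (∀ j : Fin S.k, j.val + 1 = i.val → e ∈ S.Right p j) ∧
    ∀ j : Fin S.k, i.val + 1 = j.val → e ∈ S.Left p j}

/-- The edges of the union of all the paths. -/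
def U : Set S.D.Edge := ⋃ i, S.D.edges (p i)

end CutSetting

/-! Each path `p i` joins the two copies of one vertex of the cut path, so it splits `D` into a left
and a right side. The path `p j` with `j > i` has both ends on the right of `p i`. Since the two
paths meet in at most one subpath, `p j` never crosses to the left. Hence `Left` grows with the
index, `Right` shrinks, and `Left ∩ Right` at one index is contained in the path itself
(`Left_mono`, `Right_anti`, `mem_edges_of_mem_Left_of_mem_Right`). An edge of `Ω_i ∩ Ω_j` lies in
`Left` of `i + 1` and `Right` of `j - 1`, so for every `z` strictly between it lies in both regions
at `z`, hence on `p z`. Conversely, `p (i + 1)` lies in `Ω_i` and `p (j - 1)` lies in `Ω_j`. Among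
three distinct indices two differ by at least two, which gives the last claim.

The topological input is combinatorial. Euler's formula makes the cellular complex of `G` exact
modulo two (`exists_coboundary_of_isPlanar`). Projected to the dual of `G`, a path between the two
copies closes up to a cycle, hence is a coboundary. Its potential, lifted to `D`, is a two-colouring
of darts that changes exactly across the path; summing its jumps around vertices shows that on the
outer face it changes only at the two ends (`exists_side`, `exists_isLeftSide`). Conversely, a
simple path alone does not separate (`DartConnected.eq_of_isPath`), so the bounded regions are
exactly these sides (`edge_mem_boundedEdges_iff`). -/

set_option linter.unusedSectionVars false

/-! ### Rotation systems: orbits, invariant functions, connectivity -/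

namespace EmbGraph

variable {δ : Type*} (M : EmbGraph δ)

theorem tail_eq_tail_iff {d d' : δ} : M.tail d = M.tail d' ↔ M.σ.SameCycle d d' := Quotient.eq

theorem face_eq_face_iff {d d' : δ} : M.face d = M.face d' ↔ M.φ.SameCycle d d' := Quotient.eq

@[simp] theorem tail_σ (d : δ) : M.tail (M.σ d) = M.tail d :=
  M.tail_eq_tail_iff.2 (Equiv.Perm.sameCycle_apply_left.2 (Equiv.Perm.SameCycle.refl _ _))

@[simp] theorem face_φ (d : δ) : M.face (M.φ d) = M.face d :=
  M.face_eq_face_iff.2 (Equiv.Perm.sameCycle_apply_left.2 (Equiv.Perm.SameCycle.refl _ _))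

@[simp] theorem edge_α (d : δ) : M.edge (M.α d) = M.edge d :=
  Quotient.sound (Equiv.Perm.sameCycle_apply_left.2 (Equiv.Perm.SameCycle.refl _ _))

@[simp] theorem head_α (d : δ) : M.head (M.α d) = M.tail d := by
  rw [head, M.α_α]

@[simp] theorem σ_φ (d : δ) : M.σ (M.φ d) = M.α d := by simp [φ]

@[simp] theorem φ_α_σ (d : δ) : M.φ (M.α (M.σ d)) = d := by simp [φ, M.α_α]

theorem φ_eq_iff {d d' : δ} : M.φ d = d' ↔ M.σ d' = M.α d := by
  rw [← M.σ_φ]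
  exact ⟨fun h => h ▸ rfl, fun h => (M.σ.injective h).symm⟩

@[simp] theorem tail_φ (d : δ) : M.tail (M.φ d) = M.head d := by
  rw [← M.tail_σ, M.σ_φ]; rfl

theorem edge_eq_edge_iff {d d' : δ} : M.edge d = M.edge d' ↔ d' = d ∨ d' = M.α d := by
  constructor
  · intro h
    obtain ⟨n, rfl⟩ : M.α.SameCycle d d' := Quotient.exact h
    have h2 : M.α ^ 2 = 1 := by
      ext x; simp [pow_two, M.α_α]
    rcases Int.even_or_odd' n with ⟨k, rfl | rfl⟩
    · left; rw [zpow_mul]; norm_cast; simp [h2]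
    · right; rw [zpow_add, zpow_mul]; norm_cast; simp [h2]
  · rintro (rfl | rfl) <;> simp

theorem tail_surjective (v : M.Vertex) : ∃ d, M.tail d = v := Quotient.exists_rep v

theorem face_surjective (v : M.Face) : ∃ d, M.face d = v := Quotient.exists_rep v

theorem edge_surjective (v : M.Edge) : ∃ d, M.edge d = v := Quotient.exists_rep v

instance [Finite δ] : Finite M.Vertex := Quotient.finite _
instance [Finite δ] : Finite M.Edge := Quotient.finite _
instance [Finite δ] : Finite M.Face := Quotient.finite _

theorem eq_of_tail_eq {β : Type*} {g : δ → β} (hg : ∀ d, g (M.σ d) = g d) {d d' : δ}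
    (h : M.tail d = M.tail d') : g d = g d' := by
  obtain ⟨n, rfl⟩ := M.tail_eq_tail_iff.1 h
  induction n with
  | zero => rfl
  | succ n ih => 
    have := ih (M.tail_eq_tail_iff.2 ⟨_, rfl⟩)
    rw [this, add_comm, zpow_add, zpow_one, Equiv.Perm.mul_apply, hg]
  | pred n ih =>
    have := ih (M.tail_eq_tail_iff.2 ⟨_, rfl⟩)
    rw [this, ← hg ((M.σ ^ (-(n : ℤ) - 1)) d), ← Equiv.Perm.mul_apply, ← zpow_one_add]
    congr 3; ring

theorem eq_of_face_eq {β : Type*} {g : δ → β} (hg : ∀ d, g (M.φ d) = g d) {d d' : δ}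
    (h : M.face d = M.face d') : g d = g d' :=
  eq_of_tail_eq ⟨M.φ, M.α, M.α_α, M.α_ne⟩ hg h

/-- The rotation and the reversal of darts generate a transitive permutation group. -/
def DartConnected : Prop :=
  ∀ Q : δ → Prop, (∀ d, Q (M.σ d) = Q d) → (∀ d, Q (M.α d) = Q d) → ∀ d d', Q d = Q d'

theorem IsPlanar.dartConnected {M : EmbGraph δ} (h : M.IsPlanar) : M.DartConnected := by
  intro Q hσ hα d d'
  obtain ⟨p, hp⟩ := h.1 (M.tail d) (M.tail d')
  induction p generalizing d with
  | nil => exact M.eq_of_tail_eq hσ hp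
  | cons e p ih =>
    rw [M.eq_of_tail_eq hσ hp.1.symm, ← hα e]
    exact ih _ hp.2

theorem DartConnected.of_φ {M : EmbGraph δ} (h : M.DartConnected) (Q : δ → Prop)
    (hφ : ∀ d, Q (M.φ d) = Q d) (hα : ∀ d, Q (M.α d) = Q d) (d d' : δ) : Q d = Q d' := by
  refine h Q (fun d => ?_) hα d d'
  rw [← hα, ← hφ, M.φ_α_σ]

open Classical in
theorem sum_edge_eq [Fintype δ] {R : Type*} [AddCommMonoid R] (d : δ) (ψ : δ → R) :
    ∑ d' with M.edge d' = M.edge d, ψ d' = ψ d + ψ (M.α d) := by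
  rw [← Finset.sum_pair (M.α_ne d).symm]
  congr 1
  ext x
  simp only [Finset.mem_filter, Finset.mem_univ, true_and, Finset.mem_insert, Finset.mem_singleton]
  rw [eq_comm, M.edge_eq_edge_iff]

/-! ### Exactness modulo two on the sphere -/

section exact

open Classical

/-- The coboundary map from vertices to edges, modulo two. -/
noncomputable def coboundary : (M.Vertex → ZMod 2) →ₗ[ZMod 2] (M.Edge → ZMod 2) where
  toFun f e := f (M.tail (Quotient.out e)) + f (M.head (Quotient.out e))
  map_add' c c' := by ext F; simp; ring
  map_smul' r c := by ext F; simp; ring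

theorem coboundary_edge (f : M.Vertex → ZMod 2) (d : δ) :
    M.coboundary f (M.edge d) = f (M.tail d) + f (M.head d) := by
  have : M.edge d = M.edge (Quotient.out (M.edge d)) := (Quotient.out_eq (M.edge d)).symm
  rcases M.edge_eq_edge_iff.1 this with h | h
  · simp [coboundary, h]
  · simp only [coboundary, LinearMap.coe_mk, AddHom.coe_mk, h, head_α]
    exact add_comm _ _

variable [Fintype δ]

/-- The boundary map from edges to faces of the dual chain complex, modulo two. -/
noncomputable def faceSum : (M.Edge → ZMod 2) →ₗ[ZMod 2] (M.Face → ZMod 2) where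
  toFun c F := ∑ d with M.face d = F, c (M.edge d)
  map_add' c c' := by ext F; simp [Finset.sum_add_distrib]
  map_smul' r c := by ext F; simp [Finset.mul_sum]

/-- `φ` permutes the darts of a face and sends the head of a dart to the tail of the next, so every
vertex value occurs twice in the sum over a face. -/
theorem range_coboundary_le : LinearMap.range M.coboundary ≤ LinearMap.ker M.faceSum := by
  rintro _ ⟨f, rfl⟩
  rw [LinearMap.mem_ker]
  ext F
  have : ∑ d with M.face d = F, f (M.head d) = ∑ d with M.face d = F, f (M.tail d) := by
    refine Finset.sum_equiv M.φ (by simp) (by simp)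
  simp only [faceSum, LinearMap.coe_mk, AddHom.coe_mk, coboundary_edge, Finset.sum_add_distrib,
    this, CharTwo.add_self_eq_zero, Pi.zero_apply]

theorem faceSum_single (d : δ) :
    M.faceSum (Pi.single (M.edge d) 1) = Pi.single (M.face d) 1 + Pi.single (M.face (M.α d)) 1 := by
  ext F
  simp only [faceSum, LinearMap.coe_mk, AddHom.coe_mk, Pi.add_apply, Pi.single_apply]
  rw [Finset.sum_ite, Finset.sum_const_zero, add_zero, Finset.filter_comm, Finset.sum_filter,
    sum_edge_eq]
  simp only [eq_comm]

/-- A dimension count. Connectivity bounds the kernel of the coboundary and the cokernel of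
`faceSum` by dimension one each. So the range of the coboundary has dimension at least `V - 1` and
the kernel of `faceSum` at most `E - F + 1`; Euler's formula makes these bounds equal, and one space
contains the other. -/
theorem exists_coboundary_of_isPlanar {M : EmbGraph δ} (h : M.IsPlanar) (c : δ → ZMod 2)
    (hα : ∀ d, c (M.α d) = c d) (hc : ∀ F, ∑ d with M.face d = F, c d = 0) :
    ∃ f : M.Vertex → ZMod 2, ∀ d, c d = f (M.tail d) + f (M.head d) := by
  rcases isEmpty_or_nonempty δ with hδ | ⟨⟨d₀⟩⟩
  · exact ⟨0, fun d => hδ.elim d⟩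
  have := Fintype.ofFinite M.Vertex
  have := Fintype.ofFinite M.Edge
  have := Fintype.ofFinite M.Face
  have hker : Module.finrank (ZMod 2) (LinearMap.ker M.coboundary) ≤ 1 := by
    have hle : LinearMap.ker M.coboundary ≤ Submodule.span (ZMod 2) {fun _ => (1 : ZMod 2)} := by
      intro f hf
      have hf' : ∀ d, f (M.head d) = f (M.tail d) := by
        intro d
        have := congrFun hf (M.edge d)
        rw [coboundary_edge] at this
        exact (CharTwo.add_eq_zero.1 this).symm
      refine Submodule.mem_span_singleton.2 ⟨f (M.tail d₀), ?_⟩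
      ext v
      obtain ⟨d, rfl⟩ := M.tail_surjective v
      have := h.dartConnected (fun d => f (M.tail d) = f (M.tail d₀)) (by simp)
        (fun d => by show (f (M.head d) = _) = _; rw [hf']) d d₀
      simp at this
      simp [this]
    exact (Submodule.finrank_mono hle).trans ((finrank_span_le_card _).trans (by simp))
  have hrange : Fintype.card M.Face ≤ Module.finrank (ZMod 2) (LinearMap.range M.faceSum) + 1 := by
    have htop : LinearMap.range M.faceSum ⊔
        Submodule.span (ZMod 2) {Pi.single (M.face d₀) (1 : ZMod 2)} = ⊤ := by
      rw [eq_top_iff, ← (Pi.basisFun (ZMod 2) M.Face).span_eq, Submodule.span_le]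
      rintro _ ⟨F, rfl⟩
      obtain ⟨d, rfl⟩ := M.face_surjective F
      -- The image of an edge is the sum of the indicators of its two faces, so membership of an
      -- indicator in this subspace passes from a face to its neighbours.
      have := h.dartConnected.of_φ (fun d => (Pi.single (M.face d) (1 : ZMod 2) : M.Face → ZMod 2) ∈
        LinearMap.range M.faceSum ⊔
        Submodule.span (ZMod 2) {Pi.single (M.face d₀) (1 : ZMod 2)}) (by simp) (fun d => by
          have hm : M.faceSum (Pi.single (M.edge d) 1) ∈ LinearMap.range M.faceSum ⊔
            Submodule.span (ZMod 2) {Pi.single (M.face d₀) (1 : ZMod 2)} :=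
            Submodule.mem_sup_left ⟨_, rfl⟩
          rw [faceSum_single] at hm
          exact propext ⟨fun h => (Submodule.add_mem_iff_left _ h).1 hm,
            fun h => (Submodule.add_mem_iff_right _ h).1 hm⟩) d d₀
      simp only [Pi.basisFun_apply, SetLike.mem_coe]
      rw [this]
      exact Submodule.mem_sup_right (Submodule.mem_span_singleton_self _)
    have h1 := Submodule.finrank_add_le_finrank_add_finrank (LinearMap.range M.faceSum)
      (Submodule.span (ZMod 2) {Pi.single (M.face d₀) (1 : ZMod 2)})
    rw [htop, finrank_top, Module.finrank_fintype_fun_eq_card] at h1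
    exact h1.trans (Nat.add_le_add_left ((finrank_span_le_card _).trans (by simp)) _)
  have h1 := LinearMap.finrank_range_add_finrank_ker M.coboundary
  have h2 := LinearMap.finrank_range_add_finrank_ker M.faceSum
  have h3 := h.2
  simp only [Nat.card_eq_fintype_card, Module.finrank_fintype_fun_eq_card] at h1 h2 h3
  have heq := Submodule.eq_of_le_of_finrank_le M.range_coboundary_le (by omega)
  have hout : ∀ d, c (Quotient.out (M.edge d)) = c d := by
    intro d
    have : M.edge d = M.edge (Quotient.out (M.edge d)) := (Quotient.out_eq (M.edge d)).symm
    rcases M.edge_eq_edge_iff.1 this with h | h <;> rw [h]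
    exact hα d
  have hmem : (fun e : M.Edge => c (Quotient.out e)) ∈ LinearMap.ker M.faceSum := by
    rw [LinearMap.mem_ker]
    ext F
    simp only [faceSum, LinearMap.coe_mk, AddHom.coe_mk, hout, Pi.zero_apply]
    exact hc F
  rw [← heq] at hmem
  obtain ⟨f, hf⟩ := hmem
  refine ⟨f, fun d => ?_⟩
  rw [← coboundary_edge, hf]
  exact (hout d).symm

end exact

end EmbGraph

/-! ### Paths, the regions they bound, and the sides of a path -/

namespace EmbGraph

variable {δ : Type*} (M : EmbGraph δ)

theorem tail_mem_support_of_mem {u v : M.Vertex} {p : List δ} (hp : M.IsWalk u p v) {d : δ}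
    (hd : d ∈ p) : M.tail d ∈ M.support u p ∧ M.head d ∈ M.support u p := by
  induction p generalizing u with
  | nil => simp at hd
  | cons e p ih =>
    rcases List.mem_cons.1 hd with rfl | hd
    · simp [support, hp.1]
    · have := ih hp.2 hd
      simp only [support, List.map_cons, List.mem_cons] at this ⊢
      tauto

theorem tail_mem_support_of_edge_mem {u v : M.Vertex} {p : List δ} (hp : M.IsWalk u p v) {d : δ}
    (hd : M.edge d ∈ M.edges p) : M.tail d ∈ M.support u p := by
  obtain ⟨e, he, hed⟩ := hd
  rcases M.edge_eq_edge_iff.1 hed with rfl | rfl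
  · exact (M.tail_mem_support_of_mem hp he).1
  · exact (M.tail_mem_support_of_mem hp he).2

theorem length_support (u : M.Vertex) (p : List δ) : (M.support u p).length = p.length + 1 := by
  simp [support]

theorem mem_support_start (u : M.Vertex) (p : List δ) : u ∈ M.support u p := by simp [support]

theorem mem_support_end {u v : M.Vertex} {p : List δ} (hp : M.IsWalk u p v) :
    v ∈ M.support u p := by
  induction p generalizing u with
  | nil => simp [support, show u = v from hp]
  | cons e p ih =>
    have := ih hp.2
    simp only [support, List.map_cons, List.mem_cons] at this ⊢
    tauto

theorem mem_edges_cons {d : δ} {p : List δ} {e : M.Edge} :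
    e ∈ M.edges (d :: p) ↔ e = M.edge d ∨ e ∈ M.edges p := by
  simp [edges, eq_comm]

theorem isPath_cons {u v : M.Vertex} {d : δ} {p : List δ} :
    M.IsPath u (d :: p) v ↔ M.tail d = u ∧ u ∉ M.support (M.head d) p ∧
      M.IsPath (M.head d) p v := by
  simp only [IsPath, IsWalk, support, List.map_cons, List.nodup_cons]
  tauto

theorem isWalk_append {u v : M.Vertex} {p q : List δ} :
    M.IsWalk u (p ++ q) v ↔ ∃ w, M.IsWalk u p w ∧ M.IsWalk w q v := by
  induction p generalizing u with
  | nil => simp [IsWalk]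
  | cons d p ih => simp [IsWalk, ih, and_assoc]

theorem isWalk_getElem {u v : M.Vertex} {p : List δ} (hp : M.IsWalk u p v) :
    (∀ j (hj : j < p.length), M.tail p[j] = (M.support u p)[j]'(by simp [support]; omega) ∧
      M.head p[j] = (M.support u p)[j + 1]'(by simp [support]; omega)) ∧
    (M.support u p)[p.length]'(by simp [support]) = v := by
  induction p generalizing u with
  | nil => exact ⟨by simp, hp⟩
  | cons d p ih =>
    obtain ⟨h1, h2⟩ := ih hp.2
    refine ⟨fun j hj => ?_, by simpa [support] using h2⟩
    cases j with
    | zero => exact ⟨hp.1, by simp [support]⟩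
    | succ j => simpa [support] using h1 j (by simpa using hj)

open Classical in
/-- Modulo two, the boundary of a path consists of its two endpoints. -/
theorem sum_edges_isPath [Fintype δ] {u v : M.Vertex} {p : List δ} (hp : M.IsPath u p v) (ψ : M.Vertex → ZMod 2) :
    ∑ d with M.edge d ∈ M.edges p, ψ (M.tail d) = ψ u + ψ v := by
  induction p generalizing u with
  | nil =>
    rw [show u = v from hp.1]
    simp [edges, CharTwo.add_self_eq_zero]
  | cons d p ih =>
    rw [isPath_cons] at hp
    obtain ⟨rfl, hu, hp⟩ := hp
    have hd : M.edge d ∉ M.edges p := fun h => hu (M.tail_mem_support_of_edge_mem hp.1 h)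
    have : (Finset.univ.filter fun x => M.edge x ∈ M.edges (d :: p)) =
        (Finset.univ.filter fun x => M.edge x = M.edge d) ∪
        (Finset.univ.filter fun x => M.edge x ∈ M.edges p) := by
      ext x; simp [mem_edges_cons]
    have hdisj : Disjoint (Finset.univ.filter fun x => M.edge x = M.edge d)
        (Finset.univ.filter fun x => M.edge x ∈ M.edges p) := by
      rw [Finset.disjoint_filter]
      intro x _ hx hx'
      exact hd (hx ▸ hx')
    rw [Finset.sum_congr this (fun _ _ => rfl), Finset.sum_union hdisj, sum_edge_eq, ih hp]
    change ψ _ + ψ (M.head d) + (ψ (M.head d) + _) = _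
    rw [add_assoc, ← add_assoc (ψ (M.head d)), CharTwo.add_self_eq_zero, zero_add]

/-- A predicate on faces that changes only across edges of a path is constant. -/
theorem DartConnected.eq_of_isPath {M : EmbGraph δ} [Finite δ] (hM : M.DartConnected)
    {u v : M.Vertex} {p : List δ} (hp : M.IsPath u p v) {g : δ → Prop}
    (hφ : ∀ d, g (M.φ d) = g d) (hα : ∀ d, M.edge d ∉ M.edges p → g (M.α d) = g d) (d d' : δ) :
    g d = g d' := by
  induction p generalizing u with
  | nil => exact hM.of_φ g hφ (fun d => hα d (by simp [edges])) d d'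
  | cons e p ih =>
    rw [isPath_cons] at hp
    obtain ⟨rfl, hu, hp⟩ := hp
    have hστ : ∀ d, g (M.α (M.σ d)) = g d := fun d => by rw [← hφ, M.φ_α_σ]
    -- The start of the path is a leaf: `e` is the only dart of the path at it. Turning once around
    -- this vertex therefore leads from one side of `e` to the other without crossing the path, so
    -- `e` can be dropped from the barrier.
    have hedge : ∀ d, M.tail d = M.tail e → d ≠ e → M.edge d ∉ M.edges (e :: p) := by
      intro d hd hne h
      rcases M.mem_edges_cons.1 h with h | h
      · rcases M.edge_eq_edge_iff.1 h.symm with rfl | rfl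
        · exact hne rfl
        · apply hu
          rw [← hd]
          exact M.mem_support_start _ _
      · exact hu (hd ▸ M.tail_mem_support_of_edge_mem hp.1 h)
    have hpow : ∀ n : ℕ, g ((M.σ ^ n) e) = g e := by
      intro n
      induction n with
      | zero => rfl
      | succ n ihn =>
        by_cases h : (M.σ ^ (n + 1)) e = e
        · rw [h]
        · rw [← hα _ (hedge _ _ h), pow_succ', Equiv.Perm.mul_apply, hστ, ihn]
          exact (M.tail_eq_tail_iff.2 ⟨(n + 1 : ℕ), rfl⟩).symm
    have he : g (M.α e) = g e := by
      obtain ⟨n, hn⟩ := (Equiv.Perm.sameCycle_symm_apply_right.2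
        (Equiv.Perm.SameCycle.refl M.σ e)).exists_nat_pow_eq
      rw [← hpow n, hn, ← hστ (M.σ.symm e), Equiv.apply_symm_apply]
    refine ih hp (fun d hd => ?_)
    by_cases hde : M.edge d = M.edge e
    · rcases M.edge_eq_edge_iff.1 hde.symm with rfl | rfl
      · exact he
      · rw [M.α_α, he]
    · exact hα d (by rw [mem_edges_cons]; tauto)

/-- The subgraph bounded by a path and a part `X` of the boundary of the outer face is the side of the
path that contains `X`. -/
theorem edge_mem_boundedEdges_iff {M : EmbGraph δ} [Finite δ] (hM : M.DartConnected)
    {u v : M.Vertex} {p : List δ} (hp : M.IsPath u p v) (o : M.Face) (X : Set δ) {S : δ → Prop}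
    (hα : ∀ d, M.edge d ∉ M.edges p → S (M.α d) = S d)
    (hφ : ∀ d, M.face d ≠ o → S (M.φ d) = S d)
    (hX : ∀ d, d ∈ X → S d) (hX' : ∀ d, M.face d = o → S d → d ∈ X) (d : δ) :
    M.edge d ∈ M.boundedEdges o (M.edges p ∪ M.edge '' X) ↔ M.edge d ∈ M.edges p ∨ S d := by
  have hedge : ∀ {d d'}, M.edge d' = M.edge d → M.edge d ∉ M.edges p → S d = S d' := by
    intro d d' h hd
    rcases M.edge_eq_edge_iff.1 h with rfl | rfl
    · rfl
    · rw [edge_α] at hd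
      exact hα _ hd
  have hface : ∀ {d d'}, M.face d = M.face d' → M.face d ≠ o → S d = S d' := by
    intro d d' h ho
    have := M.eq_of_face_eq (g := fun x => M.face x ≠ o ∧ S x) (fun x => by
      by_cases hx : M.face x = o
      · simp [hx]
      · simp [hφ x hx]) h
    simpa [← h, ho] using this
  by_cases hd : M.edge d ∈ M.edges p
  · simp [boundedEdges, hd]
  simp only [hd, false_or]
  constructor
  · rintro ((h | ⟨x, hx, hxd⟩) | ⟨d', hd', hext⟩)
    · exact absurd h hd
    · rw [hedge hxd hd]; exact hX x hx
    · rw [hedge hd' hd]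
      by_contra hS
      obtain ⟨d₀, hd₀⟩ := M.face_surjective o
      -- This predicate holds throughout `S` and is exteriority off `S`. Edges of `X` off the path
      -- have `S` on both sides, so off `S` only the path blocks a curve; since a path does not
      -- separate, the predicate is constant, and it holds on the outer face.
      have := hM.eq_of_isPath hp (g := fun x => M.IsExterior o (M.edges p ∪ M.edge '' X) (M.face x) ∨
        S x ∧ M.face x ≠ o) (fun x => by
          by_cases hx : M.face x = o
          · simp [hx]
          · simp [hφ x hx]) (fun x hx => ?_) d' d₀
      · simp only [hS, hext, false_and, or_false, hd₀, ne_eq, not_true, and_false] at this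
        exact this.mpr Relation.ReflTransGen.refl
      · have hrefl : ∀ y, M.face y = o →
            M.IsExterior o (M.edges p ∪ M.edge '' X) (M.face y) := by
          rintro y hy; rw [hy]; exact Relation.ReflTransGen.refl
        by_cases hSx : S x
        · have hSx' : S (M.α x) := by rw [hα x hx]; exact hSx
          have h1 := hrefl x
          have h2 := hrefl (M.α x)
          simp only [hSx, hSx', eq_iff_iff]
          tauto
        · have hSx' : ¬ S (M.α x) := by rw [hα x hx]; exact hSx
          have hC : M.edge x ∉ M.edges p ∪ M.edge '' X := by
            rintro (h | ⟨y, hy, hyx⟩)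
            · exact hx h
            · rw [hedge hyx hx] at hSx
              exact hSx (hX y hy)
          simp only [hSx, hSx', false_and, or_false]
          refine propext ⟨fun h => h.tail ⟨M.α x, rfl, by rw [M.α_α], by simpa using hC⟩,
            fun h => h.tail ⟨x, rfl, rfl, hC⟩⟩
  · intro hS
    by_cases hC : M.edge d ∈ M.edges p ∪ M.edge '' X
    · exact Or.inl hC
    refine Or.inr ⟨d, rfl, fun hext => ?_⟩
    -- A curve can enter `S` without crossing the path only from a dart of the outer face in `S`.
    -- That dart belongs to `X`, so its edge is blocked.
    have key : ∀ f, M.IsExterior o (M.edges p ∪ M.edge '' X) f →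
        f = o ∨ ∀ x, M.face x = f → ¬ S x := by
      intro f hf
      induction hf with
      | refl => exact Or.inl rfl
      | tail _ hstep ih =>
        obtain ⟨x, rfl, rfl, hx⟩ := hstep
        by_cases ho : M.face (M.α x) = o
        · exact Or.inl ho
        refine Or.inr fun y hy => ?_
        rw [hface hy (by rwa [hy]), hα x (fun h => hx (Or.inl h))]
        intro hSx
        rcases ih with ih | ih
        · exact hx (Or.inr ⟨x, hX' x ih hSx, rfl⟩)
        · exact ih x rfl hSx
    rcases key _ hext with h | h
    · exact hC (Or.inr ⟨d, hX' d h hS, rfl⟩)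
    · exact h d rfl hS

/-- At a vertex outside `Z` the value of `S` is unchanged by turning around the vertex and by
reversing a dart, so it is carried along the walk. -/
theorem eq_of_isWalk_of_disjoint {u v : M.Vertex} {p : List δ} (hp : M.IsWalk u p v)
    {Z : M.Vertex → Prop} {S : δ → Prop}
    (hα : ∀ d, ¬ Z (M.tail d) → S (M.α d) = S d)
    (hσ : ∀ d, ¬ Z (M.tail d) → S (M.α (M.σ d)) = S d)
    (hZ : ∀ w ∈ M.support u p, ¬ Z w) {d d' : δ} (hd : M.tail d = u) (hd' : M.tail d' = v) :
    S d = S d' := by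
  have hvert : ∀ {d d'}, M.tail d = M.tail d' → ¬ Z (M.tail d) → S d = S d' := by
    intro d d' h hz
    have := M.eq_of_tail_eq (g := fun x => ¬ Z (M.tail x) ∧ S x) (fun x => by
      by_cases hx : Z (M.tail x)
      · simp [hx]
      · simp only [tail_σ, hx]
        rw [← hα (M.σ x) (by simpa using hx), hσ x hx]) h
    simpa [← h, hz] using this
  induction p generalizing u d with
  | nil =>
    rw [show u = v from hp] at hd
    exact hvert (hd.trans hd'.symm) (hZ _ (by rw [hd]; exact M.mem_support_end hp))
  | cons e p ih =>
    have hu : ¬ Z (M.tail d) := hZ _ (hd ▸ M.mem_support_start _ _)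
    have he : M.tail e = M.tail d := by rw [hd]; exact hp.1
    rw [hvert he.symm hu, ← hα e (he ▸ hu)]
    exact ih hp.2 (fun w hw => hZ w (by
      simp only [support, List.map_cons, List.mem_cons] at hw ⊢; tauto)) rfl

/-- A path that touches `q` at most once and whose endpoints off `q` lie on the side `S` of `q` stays on
this side. -/
theorem SingleTouch.side {M : EmbGraph δ} {u u' v v' : M.Vertex} {p q : List δ}
    (h : M.SingleTouch u p v q) (hp : M.IsPath u p u') (hq : M.IsPath v q v') {S : δ → Prop}
    (hα : ∀ d, M.edge d ∉ M.edges q → S (M.α d) = S d)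
    (hσ : ∀ d, M.tail d ∉ M.support v q → S (M.α (M.σ d)) = S d)
    {du du' : δ} (hdu : M.tail du = u) (hdu' : M.tail du' = u') (hSu : S du) (hSu' : S du')
    {d : δ} (hd : M.edge d ∈ M.edges p) (hdq : M.edge d ∉ M.edges q) : S d := by
  have hα' : ∀ d, M.tail d ∉ M.support v q → S (M.α d) = S d := fun d hd =>
    hα d (fun h => hd (M.tail_mem_support_of_edge_mem hq.1 h))
  obtain ⟨e, he, hed⟩ := hd
  suffices hSe : S e by
    rcases M.edge_eq_edge_iff.1 hed with rfl | rfl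
    · exact hSe
    · rwa [hα _ (by simpa using hdq)]
  rw [← hed] at hdq
  obtain ⟨A, B, rfl⟩ := List.append_of_mem he
  obtain ⟨w, hA, hw, hB⟩ := M.isWalk_append.1 hp.1
  have hsupp : M.support u (A ++ e :: B) = M.support u A ++ M.support (M.head e) B := by
    simp [support]
  have hnd := hp.2
  rw [hsupp, List.nodup_append'] at hnd
  have hdisj := hnd.2.2
  have fromA : (∀ z ∈ M.support u A, z ∉ M.support v q) → S e := fun hz => by
    rw [← M.eq_of_isWalk_of_disjoint hA hα' hσ hz hdu hw]
    exact hSu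
  have fromB : (∀ z ∈ M.support (M.head e) B, z ∉ M.support v q) → S e := fun hz => by
    rw [← hα e hdq, M.eq_of_isWalk_of_disjoint hB hα' hσ hz rfl hdu']
    exact hSu'
  rcases h with h | ⟨x, r, y, hr, hrs, hre⟩
  · exact fromA fun z hz => h z (by rw [hsupp]; exact List.mem_append_left _ hz)
  -- The common part `r` does not use the edge of `e`, and the pieces `A` and `B` before and after
  -- `e` have disjoint supports. Hence the connected path `r` lies entirely in one of them; the
  -- other piece avoids `q` and links `e` to an endpoint on the side `S`.
  have hclosed : ∀ f, M.edge f ∈ M.edges r →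
      (M.tail f ∈ M.support u A ↔ M.head f ∈ M.support u A) := by
    have hor : ∀ f, M.edge f ∈ M.edges r → M.edge f ∈ M.edges A ∨ M.edge f ∈ M.edges B := by
      intro f hf
      rw [hre] at hf
      obtain ⟨⟨g, hg, hgf⟩, hfq⟩ := hf
      rcases List.mem_append.1 hg with hg | hg
      · exact Or.inl ⟨g, hg, hgf⟩
      · rcases List.mem_cons.1 hg with rfl | hg
        · exact absurd (hgf ▸ hfq) hdq
        · exact Or.inr ⟨g, hg, hgf⟩
    intro f hf
    have hhead : M.head f = M.tail (M.α f) := rfl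
    rcases hor f hf with h | h
    · exact iff_of_true (M.tail_mem_support_of_edge_mem hA h)
        (hhead ▸ M.tail_mem_support_of_edge_mem hA (by simpa using h))
    · exact iff_of_false (fun h' => hdisj h' (M.tail_mem_support_of_edge_mem hB h))
        (fun h' => hdisj h' (hhead ▸ M.tail_mem_support_of_edge_mem hB (by simpa using h)))
  have hconst : ∀ z ∈ M.support x r, (z ∈ M.support u A ↔ x ∈ M.support u A) := by
    have hr' := hr.1
    clear hr hrs hre
    induction r generalizing x with
    | nil => simp [support]
    | cons f r ih =>
      intro z hz
      have h1 : x ∈ M.support u A ↔ M.head f ∈ M.support u A := by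
        rw [← hr'.1]
        exact hclosed f (by rw [mem_edges_cons]; exact Or.inl rfl)
      have hz' : z = x ∨ z ∈ M.support (M.head f) r := by
        simpa only [support, List.map_cons, List.mem_cons] using hz
      rcases hz' with rfl | hz'
      · rfl
      · rw [ih (M.head f) (fun g hg => hclosed g (by rw [mem_edges_cons]; exact Or.inr hg)) hr'.2 z hz',
          h1]
  by_cases hx : x ∈ M.support u A
  · refine fromB fun z hz hzq => hdisj ?_ hz
    exact (hconst z ((hrs z).2 ⟨by rw [hsupp]; exact List.mem_append_right _ hz, hzq⟩)).2 hx
  · refine fromA fun z hz hzq => hx ?_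
    exact (hconst z ((hrs z).2 ⟨by rw [hsupp]; exact List.mem_append_left _ hz, hzq⟩)).1 hz

end EmbGraph

/-! ### Products of disjoint transpositions, and splitting a cycle -/

section swaps

theorem prod_swap_apply_of_ne {ι X : Type*} [DecidableEq X] {f g : ι → X} {l : List ι} {x : X}
    (h : ∀ i ∈ l, x ≠ f i ∧ x ≠ g i) : (l.map fun i => Equiv.swap (f i) (g i)).prod x = x := by
  induction l with
  | nil => rfl
  | cons i l ih =>
    rw [List.map_cons, List.prod_cons, Equiv.Perm.mul_apply,
      ih (fun j hj => h j (List.mem_cons_of_mem _ hj)),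
      Equiv.swap_apply_of_ne_of_ne (h i List.mem_cons_self).1 (h i List.mem_cons_self).2]

theorem prod_swap_apply {ι X : Type*} [DecidableEq X] {f g : ι → X} {l : List ι} (hl : l.Nodup)
    (hf : Function.Injective f) (hg : Function.Injective g) (hfg : ∀ i j, f i ≠ g j) {i : ι}
    (hi : i ∈ l) :
    (l.map fun i => Equiv.swap (f i) (g i)).prod (f i) = g i ∧
      (l.map fun i => Equiv.swap (f i) (g i)).prod (g i) = f i := by
  induction l with
  | nil => simp at hi
  | cons k l ih =>
    rw [List.nodup_cons] at hl
    rw [List.map_cons, List.prod_cons, Equiv.Perm.mul_apply, Equiv.Perm.mul_apply]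
    by_cases hik : i = k
    · subst hik
      rw [prod_swap_apply_of_ne, prod_swap_apply_of_ne]
      · simp
      all_goals
        intro j hj
        have hne : i ≠ j := fun h => hl.1 (h ▸ hj)
      · exact ⟨(hfg _ _).symm, fun h => hne (hg h)⟩
      · exact ⟨fun h => hne (hf h), hfg _ _⟩
    · obtain ⟨h1, h2⟩ := ih hl.2 ((List.mem_cons.1 hi).resolve_left hik)
      rw [h1, h2, Equiv.swap_apply_of_ne_of_ne (hfg _ _).symm (fun h => hik (hg h)),
        Equiv.swap_apply_of_ne_of_ne (fun h => hik (hf h)) (hfg _ _)]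
      exact ⟨rfl, rfl⟩

/-- Composing with a transposition of two elements of a cycle splits this cycle. -/
theorem not_sameCycle_of_swap {X : Type*} [Finite X] {τ σ : Equiv.Perm X} {u l : X} (hul : u ≠ l)
    (h : τ.SameCycle u l) (hu : σ l = τ u)
    (hσ : ∀ x, τ.SameCycle u x → x ≠ u → x ≠ l → σ x = τ x) : ¬ σ.SameCycle l u := by
  classical
  have hex : ∃ n : ℕ, (τ ^ n) u = l := h.exists_nat_pow_eq
  have hn : (τ ^ Nat.find hex) u = l := Nat.find_spec hex
  have hmin : ∀ m < Nat.find hex, (τ ^ m) u ≠ l := fun m hm => Nat.find_min hex hm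
  generalize Nat.find hex = n at hn hmin
  have hn0 : n ≠ 0 := by rintro rfl; exact hul hn
  -- With `n` the first time at which `τ` takes `u` to `l`, the segment `τ u, …, τ^n u = l` is
  -- closed under `σ` and misses `u`.
  have key : ∀ k : ℕ, ∃ i, 1 ≤ i ∧ i ≤ n ∧ (σ ^ k) l = (τ ^ i) u := by
    intro k
    induction k with
    | zero => exact ⟨n, by omega, le_rfl, hn.symm⟩
    | succ k ih =>
      obtain ⟨i, h1, hi, hk⟩ := ih
      rw [pow_succ', Equiv.Perm.mul_apply, hk]
      by_cases hin : i = n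
      · exact ⟨1, le_rfl, by omega, by rw [hin, hn, hu, pow_one]⟩
      · refine ⟨i + 1, by omega, by omega, ?_⟩
        rw [pow_succ', Equiv.Perm.mul_apply, hσ _ ⟨i, by simp⟩ _ (hmin i (by omega))]
        intro hiu
        apply hmin (n - i) (by omega)
        conv_lhs => rw [← hiu]
        rw [← Equiv.Perm.mul_apply, ← pow_add, Nat.sub_add_cancel hi, hn]
  intro hc
  obtain ⟨k, hk⟩ := hc.exists_nat_pow_eq
  obtain ⟨i, h1, hi, hki⟩ := key k
  rw [hk] at hki
  have hin : i ≠ n := by rintro rfl; exact hul (hki.trans hn)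
  apply hmin (n - i) (by omega)
  conv_lhs => rw [hki]
  rw [← Equiv.Perm.mul_apply, ← pow_add, Nat.sub_add_cancel hi, hn]

end swaps

/-! ### The rotation of the cut graph -/

namespace CutSetting

variable {δ : Type*} (S : CutSetting δ)

/-- The `j`-th vertex of the path `P` in the dual, as a face of `G`. -/
def pathFace (j : Fin (S.P.length + 1)) : S.G.Face :=
  (S.G.dual.support (S.G.face S.a) S.P)[j.1]'(j.2.trans_eq (S.G.dual.length_support _ _).symm)

theorem pathFace_injective : Function.Injective S.pathFace := by
  intro i j h
  exact Fin.ext ((S.shortest.1.2.getElem_inj_iff).1 h)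

theorem face_P (j : Fin S.P.length) : S.G.face S.P[j] = S.pathFace j.castSucc :=
  ((S.G.dual.isWalk_getElem S.shortest.1.1).1 j.1 j.2).1

theorem face_α_P (j : Fin S.P.length) : S.G.face (S.G.α S.P[j]) = S.pathFace j.succ :=
  ((S.G.dual.isWalk_getElem S.shortest.1.1).1 j.1 j.2).2

theorem pathFace_zero : S.pathFace 0 = S.G.face S.a := rfl

theorem pathFace_last : S.pathFace (Fin.last _) = S.G.face S.b :=
  (S.G.dual.isWalk_getElem S.shortest.1.1).2

theorem P_injective : Function.Injective fun j : Fin S.P.length => S.P[j] := fun i j h =>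
  Fin.castSucc_injective _ (S.pathFace_injective
    (by rw [← face_P, ← face_P]; exact congrArg S.G.face h))

theorem αP_injective : Function.Injective fun j : Fin S.P.length => S.G.α S.P[j] :=
  S.G.α.injective.comp S.P_injective

theorem P_ne_αP (i j : Fin S.P.length) : S.P[i] ≠ S.G.α S.P[j] := by
  intro h
  have h1 : i.castSucc = j.succ := S.pathFace_injective (by rw [← face_P, ← face_α_P, h])
  have h2 : i.succ = j.castSucc := S.pathFace_injective (by
    rw [← face_P, ← face_α_P, h, S.G.α_α])
  simp only [Fin.ext_iff, Fin.val_castSucc, Fin.val_succ] at h1 h2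
  omega

theorem a_ne_b : S.a ≠ S.b := fun h => S.s_ne_t (by rw [← S.head_a, ← S.head_b, h])

variable [DecidableEq δ]

/-- The dart of the dual from which a dart of `D` comes. -/
def proj : S.DDart → δ
  | Sum.inl d => d
  | Sum.inr (j, false) => S.P[j]
  | Sum.inr (j, true) => S.G.α S.P[j]

/-- The dart at the `j`-th upper vertex before the slit. -/
abbrev up (j : Fin (S.P.length + 1)) : S.DDart := S.G.dual.upperDart S.P S.a j

/-- The dart at the `j`-th lower vertex before the slit. -/
abbrev lo (j : Fin (S.P.length + 1)) : S.DDart := S.G.dual.lowerDart S.P S.b j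

/-- The rotation of the dual with the edges of the path doubled. -/
abbrev dbl : Equiv.Perm S.DDart := S.G.dual.doubledRotation S.P

theorem up_zero : S.up 0 = Sum.inl S.a := rfl

theorem up_succ (j : Fin S.P.length) : S.up j.succ = Sum.inl (S.G.α S.P[j]) := rfl

theorem lo_castSucc (j : Fin S.P.length) : S.lo j.castSucc = Sum.inr (j, false) :=
  Fin.lastCases_castSucc ..

/-- The swaps that insert the lower copies of the darts along `P`. -/
def swapsFrom : Equiv.Perm S.DDart :=
  ((List.finRange S.P.length).map
    (fun j => Equiv.swap (Sum.inr (j, false) : S.DDart) (Sum.inl S.P[j]))).prod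

/-- The swaps that insert the lower copies of the reverses of the darts along `P`. -/
def swapsTo : Equiv.Perm S.DDart :=
  ((List.finRange S.P.length).map
    (fun j => Equiv.swap (Sum.inr (j, true) : S.DDart) (Sum.inl (S.G.α S.P[j])))).prod

theorem dbl_apply (x : S.DDart) :
    S.dbl x = S.swapsFrom (Equiv.sumCongr S.G.φ (Equiv.refl _) (S.swapsTo x)) := rfl

theorem swapsFrom_apply (j : Fin S.P.length) :
    S.swapsFrom (Sum.inr (j, false)) = Sum.inl S.P[j] ∧
      S.swapsFrom (Sum.inl S.P[j]) = Sum.inr (j, false) :=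
  prod_swap_apply (List.nodup_finRange _)
    (f := fun j : Fin S.P.length => (Sum.inr (j, false) : S.DDart))
    (g := fun j => Sum.inl S.P[j])
    (fun i j h => by simpa using h) (fun i j h => S.P_injective (Sum.inl_injective h))
    (by simp) (List.mem_finRange j)

theorem swapsTo_apply (j : Fin S.P.length) :
    S.swapsTo (Sum.inr (j, true)) = Sum.inl (S.G.α S.P[j]) ∧
      S.swapsTo (Sum.inl (S.G.α S.P[j])) = Sum.inr (j, true) :=
  prod_swap_apply (List.nodup_finRange _)
    (f := fun j : Fin S.P.length => (Sum.inr (j, true) : S.DDart))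
    (g := fun j => Sum.inl (S.G.α S.P[j]))
    (fun i j h => by simpa using h) (fun i j h => S.αP_injective (Sum.inl_injective h))
    (by simp) (List.mem_finRange j)

theorem swapsFrom_inl {d : δ} (h : ∀ j : Fin S.P.length, d ≠ S.P[j]) :
    S.swapsFrom (Sum.inl d) = Sum.inl d :=
  prod_swap_apply_of_ne fun j _ => ⟨by simp, fun h' => h j (Sum.inl_injective h')⟩

theorem swapsFrom_inr_true (j : Fin S.P.length) :
    S.swapsFrom (Sum.inr (j, true)) = Sum.inr (j, true) :=
  prod_swap_apply_of_ne fun j _ => ⟨by simp, by simp⟩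

theorem swapsTo_inl {d : δ} (h : ∀ j : Fin S.P.length, d ≠ S.G.α S.P[j]) :
    S.swapsTo (Sum.inl d) = Sum.inl d :=
  prod_swap_apply_of_ne fun j _ => ⟨by simp, fun h' => h j (Sum.inl_injective h')⟩

theorem swapsTo_inr_false (j : Fin S.P.length) :
    S.swapsTo (Sum.inr (j, false)) = Sum.inr (j, false) :=
  prod_swap_apply_of_ne fun j _ => ⟨by simp, by simp⟩

theorem proj_swapsFrom_inl (d : δ) : S.proj (S.swapsFrom (Sum.inl d)) = d := by
  by_cases h : ∃ j : Fin S.P.length, d = S.P[j]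
  · obtain ⟨j, rfl⟩ := h
    rw [(S.swapsFrom_apply j).2]; rfl
  · push Not at h
    rw [S.swapsFrom_inl h]; rfl

theorem dbl_inr_false (j : Fin S.P.length) : S.dbl (Sum.inr (j, false)) = Sum.inl S.P[j] := by
  rw [dbl_apply, swapsTo_inr_false]
  exact (S.swapsFrom_apply j).1

theorem dbl_inl_αP (j : Fin S.P.length) :
    S.dbl (Sum.inl (S.G.α S.P[j])) = Sum.inr (j, true) := by
  rw [dbl_apply, (S.swapsTo_apply j).2]
  exact S.swapsFrom_inr_true j

theorem dbl_inl {d : δ} (h : ∀ j : Fin S.P.length, d ≠ S.G.α S.P[j]) :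
    S.dbl (Sum.inl d) = S.swapsFrom (Sum.inl (S.G.φ d)) := by
  rw [dbl_apply, S.swapsTo_inl h]; rfl

theorem dbl_inr_true (j : Fin S.P.length) :
    S.dbl (Sum.inr (j, true)) = S.swapsFrom (Sum.inl (S.G.φ (S.G.α S.P[j]))) := by
  rw [dbl_apply, (S.swapsTo_apply j).1]; rfl

theorem dbl_lo_last : S.dbl (S.lo (Fin.last _)) = Sum.inl (S.G.φ S.b) := by
  have : S.lo (Fin.last _) = S.dbl⁻¹ (Sum.inl (S.G.φ S.b)) := Fin.lastCases_last ..
  rw [this]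
  exact Equiv.apply_symm_apply _ _

/-- A simple path does not leave its last vertex, so the dart after `b` there is not in `P` and no
lower copy is inserted before it. Its predecessor is `b`, or the lower copy of `b` when `P` arrives
along that edge. -/
theorem lo_last :
    (S.lo (Fin.last _) = Sum.inl S.b ∧ ∀ j : Fin S.P.length, S.b ≠ S.G.α S.P[j]) ∨
      ∃ j : Fin S.P.length, S.lo (Fin.last _) = Sum.inr (j, true) ∧ S.b = S.G.α S.P[j] := by
  have hb : S.swapsFrom (Sum.inl (S.G.φ S.b)) = Sum.inl (S.G.φ S.b) := by
    refine S.swapsFrom_inl fun j h => ?_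
    have := S.pathFace_injective
      ((S.face_P j).symm.trans ((h ▸ S.G.face_φ S.b).trans S.pathFace_last.symm))
    exact absurd this (Fin.castSucc_lt_last j).ne
  by_cases h : ∃ j : Fin S.P.length, S.b = S.G.α S.P[j]
  · obtain ⟨j, hj⟩ := h
    refine Or.inr ⟨j, S.dbl.injective ?_, hj⟩
    rw [dbl_lo_last, dbl_inr_true, ← hj, hb]
  · push Not at h
    refine Or.inl ⟨S.dbl.injective ?_, h⟩
    rw [dbl_lo_last, S.dbl_inl h, hb]

theorem proj_lo_last : S.proj (S.lo (Fin.last _)) = S.b := by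
  rcases S.lo_last with ⟨h, _⟩ | ⟨j, h, hj⟩ <;> rw [h]
  · rfl
  · exact hj.symm

theorem face_proj_up (j) : S.G.face (S.proj (S.up j)) = S.pathFace j := by
  cases j using Fin.cases with
  | zero => rfl
  | succ j => exact S.face_α_P j

theorem face_proj_lo (j) : S.G.face (S.proj (S.lo j)) = S.pathFace j := by
  cases j using Fin.lastCases with
  | last => rw [proj_lo_last, pathFace_last]
  | cast j => rw [lo_castSucc]; exact S.face_P j

theorem up_injective : Function.Injective S.up := fun i j h =>
  S.pathFace_injective (by rw [← face_proj_up, ← face_proj_up, h])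

theorem lo_injective : Function.Injective S.lo := fun i j h =>
  S.pathFace_injective (by rw [← face_proj_lo, ← face_proj_lo, h])

theorem a_ne_αP (j : Fin S.P.length) : S.a ≠ S.G.α S.P[j] := by
  intro h
  have := S.pathFace_injective ((S.face_α_P j).symm.trans (h ▸ S.pathFace_zero.symm))
  exact Fin.succ_ne_zero j this

theorem up_ne_lo (i j) : S.up i ≠ S.lo j := by
  intro h
  obtain rfl : i = j := S.pathFace_injective (by rw [← face_proj_up, ← face_proj_lo, h])
  cases i using Fin.lastCases with
  | cast i =>
    rw [lo_castSucc] at h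
    generalize i.castSucc = k at h
    cases k using Fin.cases with
    | zero => simp [up_zero] at h
    | succ j => simp [up_succ] at h
  | last =>
    rcases S.lo_last with ⟨h1, h2⟩ | ⟨j, h1, h2⟩ <;> rw [h1] at h
    · generalize Fin.last S.P.length = i at h
      cases i using Fin.cases with
      -- Here `P` is empty and both corners lie at one vertex; they differ because `s ≠ t`.
      | zero => exact S.a_ne_b (Sum.inl_injective h)
      | succ j => exact h2 j (Sum.inl_injective h).symm
    · generalize Fin.last S.P.length = i at h
      cases i using Fin.cases with
      | zero => simp [up_zero] at h
      | succ j => simp [up_succ] at h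

theorem σ_up (j) : S.D.σ (S.up j) = S.dbl (S.lo j) :=
  congrArg S.dbl (prod_swap_apply (List.nodup_finRange _) S.up_injective S.lo_injective
    S.up_ne_lo (List.mem_finRange j)).1

theorem σ_lo (j) : S.D.σ (S.lo j) = S.dbl (S.up j) :=
  congrArg S.dbl (prod_swap_apply (List.nodup_finRange _) S.up_injective S.lo_injective
    S.up_ne_lo (List.mem_finRange j)).2

/-- `x` is one of the darts at which a vertex is split. -/
def IsCorner (x : S.DDart) : Prop := ∃ j, x = S.up j ∨ x = S.lo j

theorem isCorner_up (j) : S.IsCorner (S.up j) := ⟨j, Or.inl rfl⟩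

theorem isCorner_lo (j) : S.IsCorner (S.lo j) := ⟨j, Or.inr rfl⟩

theorem σ_of_not_isCorner {x : S.DDart} (hx : ¬ S.IsCorner x) : S.D.σ x = S.dbl x :=
  congrArg S.dbl (prod_swap_apply_of_ne fun j _ =>
    ⟨fun h => hx ⟨j, Or.inl h⟩, fun h => hx ⟨j, Or.inr h⟩⟩)

@[simp] theorem α_inl (d : δ) : S.D.α (Sum.inl d) = Sum.inl (S.G.α d) := rfl

@[simp] theorem α_inr (j c) : S.D.α (Sum.inr (j, c)) = Sum.inr (j, !c) := rfl

theorem proj_α (x : S.DDart) : S.proj (S.D.α x) = S.G.α (S.proj x) := by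
  rcases x with d | ⟨j, _ | _⟩
  · rfl
  · rfl
  · exact (S.G.α_α _).symm

theorem proj_dbl {x : S.DDart} (h : ∀ j, x ≠ S.up (Fin.succ j)) (h' : ∀ j, x ≠ S.lo (Fin.castSucc j)) :
    S.proj (S.dbl x) = S.G.φ (S.proj x) := by
  rcases x with d | ⟨j, _ | _⟩
  · rw [dbl_inl, proj_swapsFrom_inl]; rfl
    rintro j rfl
    exact h j rfl
  · exact absurd (S.lo_castSucc j).symm (h' j)
  · rw [dbl_inr_true, proj_swapsFrom_inl]; rfl

theorem proj_σ {x : S.DDart} (hx : ¬ S.IsCorner x) : S.proj (S.D.σ x) = S.G.φ (S.proj x) := by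
  rw [S.σ_of_not_isCorner hx, proj_dbl]
  · rintro j rfl; exact hx (S.isCorner_up _)
  · rintro j rfl; exact hx (S.isCorner_lo _)

/-- `α ∘ σ` is the inverse of `φ`, a backward step along a face walk. Away from corners it stays in
one face of the dual, that is, at one vertex of `G`, recorded by the head. -/
theorem head_proj_α_σ {x : S.DDart} (hx : ¬ S.IsCorner x) :
    S.G.head (S.proj (S.D.α (S.D.σ x))) = S.G.head (S.proj x) := by
  rw [proj_α, S.proj_σ hx, EmbGraph.head_α, EmbGraph.tail_φ]

theorem face_proj_dbl (x : S.DDart) : S.G.face (S.proj (S.dbl x)) = S.G.face (S.proj x) := by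
  by_cases h : ∃ j, x = S.up (Fin.succ j)
  · obtain ⟨j, rfl⟩ := h
    rw [up_succ, dbl_inl_αP]; rfl
  by_cases h' : ∃ j, x = S.lo (Fin.castSucc j)
  · obtain ⟨j, rfl⟩ := h'
    rw [lo_castSucc, dbl_inr_false]; rfl
  push Not at h h'
  rw [S.proj_dbl h h', EmbGraph.face_φ]

theorem face_proj_σ (x : S.DDart) : S.G.face (S.proj (S.D.σ x)) = S.G.face (S.proj x) := by
  by_cases h : S.IsCorner x
  · obtain ⟨j, rfl | rfl⟩ := h
    · rw [σ_up, face_proj_dbl, face_proj_lo, face_proj_up]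
    · rw [σ_lo, face_proj_dbl, face_proj_lo, face_proj_up]
  · rw [S.σ_of_not_isCorner h, face_proj_dbl]

theorem sameCycle_dbl_inl_proj (x : S.DDart) : S.dbl.SameCycle x (Sum.inl (S.proj x)) := by
  rcases x with d | ⟨j, _ | _⟩
  · exact Equiv.Perm.SameCycle.refl _ _
  · exact ⟨1, by rw [zpow_one, dbl_inr_false]; rfl⟩
  · exact Equiv.Perm.SameCycle.symm ⟨1, by rw [zpow_one]; exact S.dbl_inl_αP j⟩

theorem sameCycle_dbl {x y : S.DDart} (h : S.G.face (S.proj x) = S.G.face (S.proj y)) :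
    S.dbl.SameCycle x y := by
  have := S.G.eq_of_face_eq (g := fun d => S.dbl.SameCycle x (Sum.inl d)) (fun d => ?_) h
  · exact (this.mp (S.sameCycle_dbl_inl_proj x)).trans (S.sameCycle_dbl_inl_proj y).symm
  have hd : S.dbl.SameCycle (Sum.inl d) (S.swapsFrom (Sum.inl (S.G.φ d))) := by
    by_cases hd : ∃ j : Fin S.P.length, d = S.G.α S.P[j]
    · obtain ⟨j, rfl⟩ := hd
      -- The inserted lower copy makes the step from `d` to its successor take two turns.
      exact ⟨2, by
        rw [show (2 : ℤ) = 1 + 1 from rfl, zpow_add, zpow_one, Equiv.Perm.mul_apply, dbl_inl_αP,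
          dbl_inr_true]⟩
    · push Not at hd
      exact ⟨1, by rw [zpow_one, S.dbl_inl hd]⟩
  have hd' := hd.trans (S.sameCycle_dbl_inl_proj _)
  rw [proj_swapsFrom_inl] at hd'
  exact propext ⟨fun h => h.trans hd'.symm, fun h => h.trans hd'⟩

theorem face_proj_eq_of_tail_eq {x y : S.DDart} (h : S.D.tail x = S.D.tail y) :
    S.G.face (S.proj x) = S.G.face (S.proj y) :=
  S.D.eq_of_tail_eq (g := fun x => S.G.face (S.proj x)) S.face_proj_σ h

/-- Before the cut, `up i` and `lo i` lie on one cycle of `dbl`, and as `P` is simple no other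
corner lies on it. The cut therefore acts on this cycle by a single transposition, which splits it.
-/
theorem tail_lo_ne_tail_up [Finite δ] (i j) : S.D.tail (S.lo i) ≠ S.D.tail (S.up j) := by
  intro h
  obtain rfl : i = j := S.pathFace_injective (by
    rw [← face_proj_lo, ← face_proj_up]; exact S.face_proj_eq_of_tail_eq h)
  refine not_sameCycle_of_swap (S.up_ne_lo i i)
    (S.sameCycle_dbl (by rw [face_proj_up, face_proj_lo])) (S.σ_lo i) (fun x hx hu hl => ?_)
    (S.D.tail_eq_tail_iff.1 h)
  refine S.σ_of_not_isCorner fun ⟨k, hk⟩ => ?_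
  have hface : S.G.face (S.proj x) = S.pathFace i := by
    rw [← face_proj_up]
    exact (EmbGraph.eq_of_tail_eq ⟨S.dbl, S.D.α, S.D.α_α, S.D.α_ne⟩
      (g := fun x => S.G.face (S.proj x)) S.face_proj_dbl (Quotient.sound hx)).symm
  rcases hk with rfl | rfl
  · rw [face_proj_up] at hface
    exact hu (S.pathFace_injective hface ▸ rfl)
  · rw [face_proj_lo] at hface
    exact hl (S.pathFace_injective hface ▸ rfl)

theorem tail_up_injective : Function.Injective fun j => S.D.tail (S.up j) := fun i j h =>
  S.pathFace_injective (by
    rw [← face_proj_up, ← face_proj_up]; exact S.face_proj_eq_of_tail_eq h)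

theorem tail_lo_injective : Function.Injective fun j => S.D.tail (S.lo j) := fun i j h =>
  S.pathFace_injective (by
    rw [← face_proj_lo, ← face_proj_lo]; exact S.face_proj_eq_of_tail_eq h)

end CutSetting

/-! ### Boundary walks of the cut graph -/

namespace CutSetting

variable {δ : Type*} [DecidableEq δ] (S : CutSetting δ)

/-- The outer face is on the left of its darts, so its walk follows the upper copy of `P` backwards
and the lower copy forwards. -/
theorem φ_up_succ (j : Fin S.P.length) : S.D.φ (S.up j.succ) = S.up j.castSucc := by
  rw [EmbGraph.φ_eq_iff, σ_up, lo_castSucc, dbl_inr_false, up_succ, α_inl, S.G.α_α]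

theorem φ_lo_castSucc (j : Fin S.P.length) : S.D.φ (S.lo j.castSucc) = S.lo j.succ := by
  rw [EmbGraph.φ_eq_iff, σ_lo, up_succ, dbl_inl_αP, lo_castSucc]; rfl

theorem head_proj_of_φ_eq_up_last {x : S.DDart} (h : S.D.φ x = S.up (Fin.last _)) :
    S.G.head (S.proj x) = S.t := by
  rw [EmbGraph.φ_eq_iff, σ_up, dbl_lo_last] at h
  have := congrArg S.proj h
  rw [proj_α] at this
  rw [← S.head_b, ← S.G.tail_φ S.b]
  exact congrArg S.G.tail this.symm

theorem head_proj_of_φ_eq_lo_zero {x : S.DDart} (h : S.D.φ x = S.lo 0) :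
    S.G.head (S.proj x) = S.s := by
  rw [EmbGraph.φ_eq_iff, σ_lo, up_zero, S.dbl_inl S.a_ne_αP] at h
  have := congrArg S.proj h
  rw [proj_α, proj_swapsFrom_inl] at this
  rw [← S.head_a, ← S.G.tail_φ S.a]
  exact congrArg S.G.tail this.symm

/-- A step of a boundary walk of `D` stays within a face of the dual, follows one of the copies of the
path, or leaves the face `s` or `t` at the end of an outer arc. -/
theorem φ_cases (x : S.DDart) :
    (¬ S.IsCorner (S.D.φ x) ∧ S.G.head (S.proj (S.D.φ x)) = S.G.head (S.proj x)) ∨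
    (∃ j, x = S.up (Fin.succ j)) ∨ (∃ j, x = S.lo (Fin.castSucc j)) ∨
    (S.D.φ x = S.up (Fin.last _) ∧ S.G.head (S.proj x) = S.t) ∨
    (S.D.φ x = S.lo 0 ∧ S.G.head (S.proj x) = S.s) := by
  by_cases hc : S.IsCorner (S.D.φ x)
  · right
    obtain ⟨j, hj | hj⟩ := hc
    · cases j using Fin.lastCases with
      | last => exact Or.inr (Or.inr (Or.inl ⟨hj, S.head_proj_of_φ_eq_up_last hj⟩))
      | cast j =>
        rw [← φ_up_succ] at hj
        exact Or.inl ⟨j, S.D.φ.injective hj⟩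
    · cases j using Fin.cases with
      | zero => exact Or.inr (Or.inr (Or.inr ⟨hj, S.head_proj_of_φ_eq_lo_zero hj⟩))
      | succ j =>
        rw [← φ_lo_castSucc] at hj
        exact Or.inr (Or.inl ⟨j, S.D.φ.injective hj⟩)
  · left
    refine ⟨hc, ?_⟩
    rw [← S.head_proj_α_σ hc, EmbGraph.σ_φ, S.D.α_α]

end CutSetting

/-! ### Arcs of a face walk -/

namespace EmbGraph

variable {δ : Type*} (M : EmbGraph δ)

theorem mem_faceArc_self {a b : δ} (h : a ≠ b) : a ∈ M.faceArc a b :=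
  ⟨0, rfl, fun m hm => by obtain rfl : m = 0 := by omega
                          exact h⟩

theorem φ_mem_faceArc {a b d : δ} (h : d ∈ M.faceArc a b) : M.φ d ∈ M.faceArc a b ∨ M.φ d = b := by
  obtain ⟨n, rfl, hn⟩ := h
  by_cases hb : M.φ ((M.φ ^ n) a) = b
  · exact Or.inr hb
  · refine Or.inl ⟨n + 1, by rw [pow_succ']; rfl, fun m hm => ?_⟩
    rcases Nat.lt_or_ge m (n + 1) with h | h
    · exact hn m (by omega)
    · obtain rfl : m = n + 1 := by omega
      rwa [pow_succ']

theorem face_of_mem_faceArc {a b d : δ} (h : d ∈ M.faceArc a b) : M.face d = M.face a := by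
  obtain ⟨n, rfl, -⟩ := h
  exact (M.face_eq_face_iff.2 ⟨n, rfl⟩).symm

theorem faceArc_induction {a b : δ} {T : δ → Prop} (ha : T a)
    (hT : ∀ d ∈ M.faceArc a b, T d → M.φ d ∈ M.faceArc a b → T (M.φ d)) :
    ∀ d ∈ M.faceArc a b, T d := by
  rintro _ ⟨n, rfl, hn⟩
  induction n with
  | zero => exact ha
  | succ n ih =>
    have hn' : ∀ m ≤ n, (M.φ ^ m) a ≠ b := fun m hm => hn m (by omega)
    have := hT _ ⟨n, rfl, hn'⟩ (ih hn')
    rw [pow_succ']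
    exact this ⟨n + 1, by rw [pow_succ']; rfl, hn⟩

/-- On a finite set the walk from `a` must return to `a`; if it cannot do so inside the arc, it
meets `b` first. -/
theorem exists_φ_eq_of_faceArc [Finite δ] {a b : δ} (h : a ≠ b)
    (ha : ∀ d ∈ M.faceArc a b, M.φ d ≠ a) : ∃ d ∈ M.faceArc a b, M.φ d = b := by
  by_contra! hcon
  have hall : ∀ n : ℕ, (M.φ ^ n) a ∈ M.faceArc a b := by
    intro n
    induction n with
    | zero => exact M.mem_faceArc_self h
    | succ n ih =>
      rw [pow_succ']
      exact (M.φ_mem_faceArc ih).resolve_right (hcon _ ih)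
  have hpos := orderOf_pos M.φ
  apply ha _ (hall (orderOf M.φ - 1))
  rw [← Equiv.Perm.mul_apply, ← pow_succ', Nat.sub_add_cancel hpos, pow_orderOf_eq_one]
  rfl

end EmbGraph

/-! ### The outer face and connectivity of the cut graph -/

namespace CutSetting

variable {δ : Type*} [DecidableEq δ] (S : CutSetting δ)

/-- The darts on the left part of the outer face. -/
abbrev leftArc : Set S.DDart := S.D.faceArc (S.up 0) (S.lo 0)

/-- The darts on the right part of the outer face. -/
abbrev rightArc : Set S.DDart := S.D.faceArc (S.lo (Fin.last _)) (S.up (Fin.last _))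

/-- The walk stays in the face `s` of the dual until it reaches the slit. Leaving at the far end
would need the face `t`, and `s ≠ t`. -/
theorem leftArc_step {x : S.DDart} (hx : x = S.up 0 ∨ ¬ S.IsCorner x)
    (hs : S.G.head (S.proj x) = S.s) :
    (¬ S.IsCorner (S.D.φ x) ∧ S.G.head (S.proj (S.D.φ x)) = S.s) ∨ S.D.φ x = S.lo 0 := by
  rcases S.φ_cases x with h | ⟨j, rfl⟩ | ⟨j, rfl⟩ | h | h
  · exact Or.inl ⟨h.1, h.2.trans hs⟩
  · rcases hx with hx | hx
    · exact absurd (S.up_injective hx) (Fin.succ_ne_zero j)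
    · exact absurd (S.isCorner_up _) hx
  · rcases hx with hx | hx
    · exact absurd hx.symm (S.up_ne_lo _ _)
    · exact absurd (S.isCorner_lo _) hx
  · exact absurd (hs.symm.trans h.2) S.s_ne_t
  · exact Or.inr h.1

theorem leftArc_spec : ∀ x ∈ S.leftArc,
    (x = S.up 0 ∨ ¬ S.IsCorner x) ∧ S.G.head (S.proj x) = S.s := by
  refine S.D.faceArc_induction ⟨Or.inl rfl, S.head_a⟩ fun d _ hd hφ => ?_
  rcases S.leftArc_step hd.1 hd.2 with h | h
  · exact ⟨Or.inr h.1, h.2⟩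
  · obtain ⟨n, hn, hn'⟩ := hφ
    exact absurd (hn.symm.trans h) (hn' n le_rfl)

theorem not_isCorner_φ_of_mem_leftArc {x : S.DDart} (hx : x ∈ S.leftArc) (h : S.D.φ x ≠ S.lo 0) :
    ¬ S.IsCorner (S.D.φ x) :=
  ((S.leftArc_step (S.leftArc_spec x hx).1 (S.leftArc_spec x hx).2).resolve_right h).1

theorem exists_leftArc_end [Finite δ] : ∃ x ∈ S.leftArc, S.D.φ x = S.lo 0 := by
  refine S.D.exists_φ_eq_of_faceArc (S.up_ne_lo _ _) fun d hd h => ?_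
  exact S.not_isCorner_φ_of_mem_leftArc hd (h ▸ S.up_ne_lo _ _) (h ▸ S.isCorner_up _)

theorem rightArc_step {x : S.DDart} (hx : x = S.lo (Fin.last _) ∨ ¬ S.IsCorner x)
    (hs : S.G.head (S.proj x) = S.t) :
    (¬ S.IsCorner (S.D.φ x) ∧ S.G.head (S.proj (S.D.φ x)) = S.t) ∨
      S.D.φ x = S.up (Fin.last _) := by
  rcases S.φ_cases x with h | ⟨j, rfl⟩ | ⟨j, rfl⟩ | h | h
  · exact Or.inl ⟨h.1, h.2.trans hs⟩
  · rcases hx with hx | hx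
    · exact absurd hx (S.up_ne_lo _ _)
    · exact absurd (S.isCorner_up _) hx
  · rcases hx with hx | hx
    · exact absurd (S.lo_injective hx) (Fin.castSucc_lt_last j).ne
    · exact absurd (S.isCorner_lo _) hx
  · exact Or.inr h.1
  · exact absurd (h.2.symm.trans hs) S.s_ne_t

theorem rightArc_spec : ∀ x ∈ S.rightArc,
    (x = S.lo (Fin.last _) ∨ ¬ S.IsCorner x) ∧ S.G.head (S.proj x) = S.t := by
  refine S.D.faceArc_induction ⟨Or.inl rfl, by rw [proj_lo_last, S.head_b]⟩ fun d _ hd hφ => ?_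
  rcases S.rightArc_step hd.1 hd.2 with h | h
  · exact ⟨Or.inr h.1, h.2⟩
  · obtain ⟨n, hn, hn'⟩ := hφ
    exact absurd (hn.symm.trans h) (hn' n le_rfl)

theorem not_isCorner_φ_of_mem_rightArc {x : S.DDart} (hx : x ∈ S.rightArc)
    (h : S.D.φ x ≠ S.up (Fin.last _)) : ¬ S.IsCorner (S.D.φ x) :=
  ((S.rightArc_step (S.rightArc_spec x hx).1 (S.rightArc_spec x hx).2).resolve_right h).1

theorem exists_rightArc_end [Finite δ] : ∃ x ∈ S.rightArc, S.D.φ x = S.up (Fin.last _) := by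
  refine S.D.exists_φ_eq_of_faceArc (S.up_ne_lo _ _).symm fun d hd h => ?_
  exact S.not_isCorner_φ_of_mem_rightArc hd (h ▸ (S.up_ne_lo _ _).symm) (h ▸ S.isCorner_lo _)

theorem face_up (j) : S.D.face (S.up j) = S.outer := by
  induction j using Fin.induction with
  | zero => rfl
  | succ j ih => rw [← ih, ← φ_up_succ, EmbGraph.face_φ]

theorem face_lo [Finite δ] (j) : S.D.face (S.lo j) = S.outer := by
  induction j using Fin.induction with
  | zero =>
    obtain ⟨x, hx, h⟩ := S.exists_leftArc_end
    rw [← h, EmbGraph.face_φ]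
    exact S.D.face_of_mem_faceArc hx
  | succ j ih => rw [← ih, ← φ_lo_castSucc, EmbGraph.face_φ]

/-- All corners lie on the outer face, so an invariant predicate has one value on them and cannot
tell `dbl` from the cut rotation. It is then constant on the cycles of `dbl`, which are the faces of
`G`, and connectivity of `G` applies. -/
theorem dartConnected [Finite δ] : S.D.DartConnected := by
  intro Q hσ hα
  have hφ : ∀ d, Q (S.D.φ d) = Q d := fun d => by rw [← hσ, S.D.σ_φ, hα]
  have hup : ∀ j, Q (S.up j) = Q (S.up 0) := fun j =>
    S.D.eq_of_face_eq hφ ((S.face_up j).trans (S.face_up 0).symm)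
  have hlo : ∀ j, Q (S.lo j) = Q (S.up 0) := fun j =>
    S.D.eq_of_face_eq hφ ((S.face_lo j).trans (S.face_up 0).symm)
  have hdbl : ∀ x, Q (S.dbl x) = Q x := by
    intro x
    by_cases hx : S.IsCorner x
    · obtain ⟨j, rfl | rfl⟩ := hx
      · rw [← σ_lo, hσ, hlo, hup j]
      · rw [← σ_up, hσ, hlo, hup]
    · rw [← S.σ_of_not_isCorner hx, hσ]
  have hcyc : ∀ {x y}, S.G.face (S.proj x) = S.G.face (S.proj y) → Q x = Q y := fun h =>
    EmbGraph.eq_of_tail_eq ⟨S.dbl, S.D.α, S.D.α_α, S.D.α_ne⟩ hdbl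
      (Quotient.sound (S.sameCycle_dbl h))
  intro x y
  rw [hcyc (show S.G.face (S.proj x) = S.G.face (S.proj (Sum.inl (S.proj x))) from rfl),
    hcyc (show S.G.face (S.proj y) = S.G.face (S.proj (Sum.inl (S.proj y))) from rfl)]
  exact S.planar.dartConnected.of_φ (fun d => Q (Sum.inl d))
    (fun d => hcyc (S.G.face_φ d)) (fun d => hα (Sum.inl d)) _ _

/-- The darts on the boundary of the outer face to the left of position `z`. -/
def outerLeft (z : Fin (S.P.length + 1)) : Set S.DDart :=
  {x | (∃ j : Fin S.P.length, j.succ ≤ z ∧ x = S.up j.succ) ∨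
    (∃ j : Fin S.P.length, j.succ ≤ z ∧ x = S.lo j.castSucc) ∨ x ∈ S.leftArc}

/-- The darts on the boundary of the outer face to the right of position `z`. -/
def outerRight (z : Fin (S.P.length + 1)) : Set S.DDart :=
  {x | (∃ j : Fin S.P.length, z ≤ j.castSucc ∧ x = S.up j.succ) ∨
    (∃ j : Fin S.P.length, z ≤ j.castSucc ∧ x = S.lo j.castSucc) ∨ x ∈ S.rightArc}

theorem up_mem_outerLeft {j z} (h : j ≤ z) : S.up j ∈ S.outerLeft z := by
  cases j using Fin.cases with
  | zero => exact Or.inr (Or.inr (S.D.mem_faceArc_self (S.up_ne_lo _ _)))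
  | succ j => exact Or.inl ⟨j, h, rfl⟩

theorem lo_mem_outerLeft {j z} (h : j < z) : S.lo j ∈ S.outerLeft z := by
  cases j using Fin.lastCases with
  | last => exact absurd h (Fin.le_last z).not_gt
  | cast j => exact Or.inr (Or.inl ⟨j, by simpa [Fin.lt_def, Fin.le_def, Nat.succ_le_iff] using h, rfl⟩)

theorem lo_mem_outerRight {j z} (h : z ≤ j) : S.lo j ∈ S.outerRight z := by
  cases j using Fin.lastCases with
  | last => exact Or.inr (Or.inr (S.D.mem_faceArc_self (S.up_ne_lo _ _).symm))
  | cast j => exact Or.inr (Or.inl ⟨j, h, rfl⟩)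

theorem up_mem_outerRight {j z} (h : z < j) : S.up j ∈ S.outerRight z := by
  cases j using Fin.cases with
  | zero => exact absurd h (Fin.zero_le z).not_gt
  | succ j => exact Or.inl ⟨j, by simpa [Fin.lt_def, Fin.le_def, Nat.lt_succ_iff] using h, rfl⟩

theorem outerRight_anti {z z'} (h : z ≤ z') : S.outerRight z' ⊆ S.outerRight z := by
  rintro x (⟨j, hj, rfl⟩ | ⟨j, hj, rfl⟩ | hx)
  · exact Or.inl ⟨j, h.trans hj, rfl⟩
  · exact Or.inr (Or.inl ⟨j, h.trans hj, rfl⟩)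
  · exact Or.inr (Or.inr hx)

/-- The outer walk runs from `up 0` through the left arc to `lo 0`, along the lower copy, through
the right arc, and back along the upper copy. Following it from `up 0` meets only darts of these
four kinds. -/
theorem mem_outerLeft_or_mem_outerRight [Finite δ] (z) {x : S.DDart} (hx : S.D.face x = S.outer) :
    x ∈ S.outerLeft z ∨ x ∈ S.outerRight z := by
  have hup : ∀ j, S.up j ∈ S.outerLeft z ∨ S.up j ∈ S.outerRight z := fun j =>
    (le_or_gt j z).imp S.up_mem_outerLeft S.up_mem_outerRight
  have hlo : ∀ j, S.lo j ∈ S.outerLeft z ∨ S.lo j ∈ S.outerRight z := fun j =>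
    (lt_or_ge j z).imp S.lo_mem_outerLeft S.lo_mem_outerRight
  obtain ⟨n, rfl⟩ := (S.D.face_eq_face_iff.1 hx.symm).exists_nat_pow_eq
  clear hx
  induction n with
  | zero => exact hup 0
  | succ n ih =>
    rw [pow_succ', Equiv.Perm.mul_apply]
    rcases ih with (⟨j, _, h⟩ | ⟨j, _, h⟩ | h) | (⟨j, _, h⟩ | ⟨j, _, h⟩ | h)
    · rw [h, φ_up_succ]; exact hup _
    · rw [h, φ_lo_castSucc]; exact hlo _
    · rcases S.D.φ_mem_faceArc h with h | h
      · exact Or.inl (Or.inr (Or.inr h))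
      · rw [h]; exact hlo 0
    · rw [h, φ_up_succ]; exact hup _
    · rw [h, φ_lo_castSucc]; exact hlo _
    · rcases S.D.φ_mem_faceArc h with h | h
      · exact Or.inr (Or.inr (Or.inr h))
      · rw [h]; exact hup _

theorem edge_image_outerLeft (z) : S.D.edge '' S.outerLeft z =
    S.upperEdges 0 z ∪ S.lowerEdges 0 z ∪ S.leftmostEdges := by
  ext e
  constructor
  · rintro ⟨_, ⟨j, hj, rfl⟩ | ⟨j, hj, rfl⟩ | h, rfl⟩
    · exact Or.inl (Or.inl ⟨j, Fin.zero_le _, hj, S.D.edge_α (Sum.inl S.P[j]) |>.symm⟩)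
    · exact Or.inl (Or.inr ⟨j, Fin.zero_le _, hj, by rw [lo_castSucc]⟩)
    · exact Or.inr ⟨_, h, rfl⟩
  · rintro ((⟨j, -, hj, rfl⟩ | ⟨j, -, hj, rfl⟩) | ⟨x, h, rfl⟩)
    · exact ⟨_, Or.inl ⟨j, hj, rfl⟩, S.D.edge_α (Sum.inl S.P[j])⟩
    · exact ⟨_, Or.inr (Or.inl ⟨j, hj, rfl⟩), by rw [lo_castSucc]⟩
    · exact ⟨_, Or.inr (Or.inr h), rfl⟩

theorem edge_image_outerRight (z) : S.D.edge '' S.outerRight z =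
    S.upperEdges z (Fin.last _) ∪ S.rightmostEdges ∪ S.lowerEdges z (Fin.last _) := by
  ext e
  constructor
  · rintro ⟨_, ⟨j, hj, rfl⟩ | ⟨j, hj, rfl⟩ | h, rfl⟩
    · exact Or.inl (Or.inl ⟨j, hj, Fin.le_last _, S.D.edge_α (Sum.inl S.P[j]) |>.symm⟩)
    · exact Or.inr ⟨j, hj, Fin.le_last _, by rw [lo_castSucc]⟩
    · exact Or.inl (Or.inr ⟨_, h, rfl⟩)
  · rintro ((⟨j, hj, -, rfl⟩ | ⟨x, h, rfl⟩) | ⟨j, hj, -, rfl⟩)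
    · exact ⟨_, Or.inl ⟨j, hj, rfl⟩, S.D.edge_α (Sum.inl S.P[j])⟩
    · exact ⟨_, Or.inr (Or.inr h), rfl⟩
    · exact ⟨_, Or.inr (Or.inl ⟨j, hj, rfl⟩), by rw [lo_castSucc]⟩

end CutSetting

/-! ### The two sides of a path between copies of a vertex -/

namespace CutSetting

variable {δ : Type*} [DecidableEq δ] (S : CutSetting δ)

/-- The face of `G` from which a vertex of `D` comes. -/
def vertexFace : S.D.Vertex → S.G.Face :=
  Quotient.lift (fun x => S.G.face (S.proj x))
    fun _ _ h => S.face_proj_eq_of_tail_eq (Quotient.sound h)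

/-- `x` lies on the slit: it is the outer one of two darts of an edge on a copy of the path. -/
def IsSlit (x : S.DDart) : Prop :=
  (∃ j, x = S.up (Fin.succ j)) ∨ ∃ j, x = S.lo (Fin.castSucc j)

theorem IsSlit.isCorner_φ {S : CutSetting δ} {x : S.DDart} (h : S.IsSlit x) :
    S.IsCorner (S.D.φ x) := by
  rcases h with ⟨j, rfl⟩ | ⟨j, rfl⟩
  · rw [φ_up_succ]; exact S.isCorner_up _
  · rw [φ_lo_castSucc]; exact S.isCorner_lo _

theorem IsSlit.isCorner {S : CutSetting δ} {x : S.DDart} (h : S.IsSlit x) : S.IsCorner x := by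
  rcases h with ⟨j, rfl⟩ | ⟨j, rfl⟩
  · exact S.isCorner_up _
  · exact S.isCorner_lo _

theorem IsSlit.not_α {S : CutSetting δ} {x : S.DDart} (h : S.IsSlit x) : ¬ S.IsSlit (S.D.α x) := by
  rcases h with ⟨j, rfl⟩ | ⟨j, rfl⟩
  · rintro (⟨i, hi⟩ | ⟨i, hi⟩)
    · rw [up_succ, up_succ, α_inl, S.G.α_α] at hi
      exact S.P_ne_αP j i (Sum.inl_injective hi)
    · rw [up_succ, lo_castSucc, α_inl] at hi
      cases hi
  · rintro (⟨i, hi⟩ | ⟨i, hi⟩)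
    · rw [up_succ, lo_castSucc] at hi
      cases hi
    · rw [lo_castSucc, lo_castSucc, α_inr] at hi
      simp at hi

/-- Away from the doubled edges, the projection to darts of `G` is injective. -/
theorem eq_inl_of_not_isSlit {x : S.DDart} (h : ¬ S.IsSlit x) (h' : ¬ S.IsSlit (S.D.α x)) :
    x = Sum.inl (S.proj x) ∧ ∀ y, S.proj y = S.proj x → y = x := by
  rcases x with d | ⟨j, _ | _⟩
  · refine ⟨rfl, ?_⟩
    rintro (e | ⟨j, _ | _⟩) hy
    · exact congrArg Sum.inl hy
    · refine absurd (Or.inl ⟨j, ?_⟩) h'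
      rw [up_succ, α_inl, ← show S.P[j] = d from hy]
    · refine absurd (Or.inl ⟨j, ?_⟩) h
      rw [up_succ]
      exact congrArg Sum.inl hy.symm
  · exact absurd (Or.inr ⟨j, (S.lo_castSucc j).symm⟩) h
  · exact absurd (Or.inr ⟨j, (S.lo_castSucc j).symm⟩) h'

variable [Fintype δ]

open Classical in
/-- A path between the two copies of the `z`-th vertex separates the darts of `D` into two sides; in the
outer face the side changes only at the two ends of the path. -/
theorem exists_side (z : Fin (S.P.length + 1)) {p : List S.DDart}
    (hp : S.D.IsPath (S.lower z) p (S.upper z)) :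
    ∃ h : S.DDart → ZMod 2, (∀ x, S.D.edge x ∉ S.D.edges p → h (S.D.α x) = h x) ∧
      (∀ x, S.D.φ x ≠ S.up z → S.D.φ x ≠ S.lo z → h (S.D.φ x) = h x) ∧
      ∀ x, S.D.φ x = S.up z → h (S.D.φ x) ≠ h x := by
  set c : S.DDart → ZMod 2 := fun x => if S.D.edge x ∈ S.D.edges p then 1 else 0 with hc
  have hcα : ∀ x, c (S.D.α x) = c x := fun x => by simp [hc]
  have hsum : ∀ ψ : S.D.Vertex → ZMod 2, ∑ x, c x * ψ (S.D.tail x) =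
      ψ (S.lower z) + ψ (S.upper z) := fun ψ => by
    rw [← S.D.sum_edges_isPath hp ψ, Finset.sum_filter]
    exact Finset.sum_congr rfl fun x _ => by simp only [hc, ite_mul, one_mul, zero_mul]
  obtain ⟨f, hf⟩ := EmbGraph.exists_coboundary_of_isPlanar S.planar
    (fun d => ∑ x, if S.proj x = d then c x else 0)
    (fun d => by
      refine Finset.sum_equiv S.D.α (by simp) fun x _ => ?_
      rw [proj_α, hcα]
      congr 1
      exact propext ⟨fun h => by rw [h, S.G.α_α], fun h => by rw [← h, S.G.α_α]⟩)
    -- Both ends of `p` come from the same face of `G`, so the projected path has zero boundary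
    -- modulo two.
    (fun F => by
      have h1 := hsum fun v => if S.vertexFace v = F then 1 else 0
      have h2 : S.vertexFace (S.lower z) = S.vertexFace (S.upper z) :=
        (S.face_proj_lo z).trans (S.face_proj_up z).symm
      rw [h2, CharTwo.add_self_eq_zero] at h1
      refine (Finset.sum_comm.trans ?_).trans h1
      refine Finset.sum_congr rfl fun x _ => ?_
      have h3 : S.vertexFace (S.D.tail x) = S.G.face (S.proj x) := rfl
      rw [Finset.sum_ite_eq, h3]
      simp)
  -- A dart off the slit takes the potential `f` of the dual face on its left. A slit dart borders
  -- the outer face instead; its value is chosen so that `h` changes by exactly `c` across its edge.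
  set h : S.DDart → ZMod 2 := fun x =>
    if S.IsSlit x then f (S.G.tail (S.proj x)) + c x else f (S.G.head (S.proj x)) with hh
  have hhα : ∀ x, h (S.D.α x) = h x + c x := by
    intro x
    by_cases hx : S.IsSlit x
    · simp only [hh, hx, hx.not_α, if_true, if_false, proj_α, EmbGraph.head_α]
      rw [add_assoc, CharTwo.add_self_eq_zero, add_zero]
    · by_cases hx' : S.IsSlit (S.D.α x)
      · simp only [hh, hx, hx', if_true, if_false, proj_α, hcα]
        rfl
      · obtain ⟨h1, h2⟩ := S.eq_inl_of_not_isSlit hx hx'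
        have h3 := hf (S.proj x)
        rw [Finset.sum_eq_single x (fun y _ hy => if_neg fun h => hy (h2 y h)) (by simp),
          if_pos rfl] at h3
        simp only [hh, hx, hx', if_false, proj_α, EmbGraph.head_α]
        rw [h3, add_comm (f (S.G.tail _)), ← add_assoc, CharTwo.add_self_eq_zero, zero_add]
  have hJ0 : ∀ x, ¬ S.IsCorner x → h (S.D.α (S.D.σ x)) + h x = 0 := by
    intro x hx
    have h1 : ¬ S.IsSlit x := fun h => hx h.isCorner
    have h2 : ¬ S.IsSlit (S.D.α (S.D.σ x)) := fun h => hx (S.D.φ_α_σ x ▸ h.isCorner_φ)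
    simp only [hh, h1, h2, if_false]
    rw [S.head_proj_α_σ hx, CharTwo.add_self_eq_zero]
  -- Since `σ` permutes the darts at a vertex and `h` changes by `c` under `α`, the jumps around the
  -- vertex add up to the boundary of `p` there. Non-corners have no jump, so a unique corner
  -- carries the whole sum.
  have hJ : ∀ x, (∀ y, S.D.tail y = S.D.tail x → S.IsCorner y → y = x) →
      h (S.D.α (S.D.σ x)) + h x = (if S.lower z = S.D.tail x then 1 else 0) +
        if S.upper z = S.D.tail x then 1 else 0 := by
    intro x hx
    rw [← hsum fun v => if v = S.D.tail x then 1 else 0]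
    have h1 : ∑ y with S.D.tail y = S.D.tail x, (h (S.D.α (S.D.σ y)) + h y) =
        h (S.D.α (S.D.σ x)) + h x := by
      refine Finset.sum_eq_single x (fun y hy hyx => hJ0 y fun hyc => hyx ?_) (by simp)
      exact hx y (Finset.mem_filter.1 hy).2 hyc
    have h2 : ∀ g : S.DDart → ZMod 2, ∑ y with S.D.tail y = S.D.tail x, g (S.D.σ y) =
        ∑ y with S.D.tail y = S.D.tail x, g y := fun g =>
      Finset.sum_equiv S.D.σ (by simp) (by simp)
    rw [← h1, Finset.sum_add_distrib, h2 fun y => h (S.D.α y)]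
    simp only [hhα, Finset.sum_add_distrib]
    rw [add_right_comm, CharTwo.add_self_eq_zero, zero_add, Finset.sum_filter]
    exact Finset.sum_congr rfl fun y _ => by simp
  have hup : ∀ j, h (S.D.α (S.D.σ (S.up j))) + h (S.up j) = if z = j then 1 else 0 := by
    intro j
    rw [hJ]
    · have h1 : S.lower z ≠ S.D.tail (S.up j) := S.tail_lo_ne_tail_up z j
      have h2 : S.upper z = S.D.tail (S.up j) ↔ z = j := S.tail_up_injective.eq_iff
      simp only [h1, h2, if_false, zero_add]
    · rintro y hy ⟨i, rfl | rfl⟩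
      · rw [S.tail_up_injective hy]
      · exact absurd hy (S.tail_lo_ne_tail_up i j)
  have hlo : ∀ j, h (S.D.α (S.D.σ (S.lo j))) + h (S.lo j) = if z = j then 1 else 0 := by
    intro j
    rw [hJ]
    · have h1 : S.upper z ≠ S.D.tail (S.lo j) := (S.tail_lo_ne_tail_up j z).symm
      have h2 : S.lower z = S.D.tail (S.lo j) ↔ z = j := S.tail_lo_injective.eq_iff
      simp only [h1, h2, if_false, add_zero]
    · rintro y hy ⟨i, rfl | rfl⟩
      · exact absurd hy.symm (S.tail_lo_ne_tail_up j i)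
      · rw [S.tail_lo_injective hy]
  have hασ : ∀ x, S.D.α (S.D.σ (S.D.φ x)) = x := fun x => by rw [S.D.σ_φ, S.D.α_α]
  refine ⟨h, fun x hx => ?_, fun x hxu hxl => ?_, fun x hx heq => ?_⟩
  · rw [hhα]; simp [hc, hx]
  · refine (CharTwo.add_eq_zero.1 ?_).symm
    by_cases hcor : S.IsCorner (S.D.φ x)
    · obtain ⟨j, hj | hj⟩ := hcor
      · have := hup j
        rw [← hj, hασ, if_neg] at this
        · exact this
        · rintro rfl; exact hxu hj
      · have := hlo j
        rw [← hj, hασ, if_neg] at this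
        · exact this
        · rintro rfl; exact hxl hj
    · have := hJ0 _ hcor
      rwa [hασ] at this
  · have := hup z
    rw [← hx, hασ, heq, CharTwo.add_self_eq_zero, if_pos rfl] at this
    exact zero_ne_one this

/-- The predicate `L` on darts of `D` singles out the side of the path `p` that contains the left part of
the outer face. -/
structure IsLeftSide (z : Fin (S.P.length + 1)) (p : List S.DDart) (L : S.DDart → Prop) : Prop where
  α : ∀ x, S.D.edge x ∉ S.D.edges p → L (S.D.α x) = L x
  φ : ∀ x, S.D.φ x ≠ S.up z → S.D.φ x ≠ S.lo z → L (S.D.φ x) = L x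
  left : ∀ x ∈ S.outerLeft z, L x
  right : ∀ x ∈ S.outerRight z, ¬ L x

/-- Along the outer walk `h` can change only on entering `up z` or `lo z`, so it is constant on
`outerLeft z` and on `outerRight z`. The jump at `up z` makes the two values differ. -/
theorem exists_isLeftSide (z : Fin (S.P.length + 1)) {p : List S.DDart}
    (hp : S.D.IsPath (S.lower z) p (S.upper z)) : ∃ L, S.IsLeftSide z p L := by
  obtain ⟨h, hα, hφ, hz⟩ := S.exists_side z hp
  have hφc : ∀ x, ¬ S.IsCorner (S.D.φ x) → h (S.D.φ x) = h x := fun x hx =>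
    hφ x (fun e => hx (e ▸ S.isCorner_up _)) (fun e => hx (e ▸ S.isCorner_lo _))
  have hupL : ∀ n : ℕ, ∀ j : Fin (S.P.length + 1), j ≤ z → z.1 = j.1 + n →
      h (S.up j) = h (S.up z) := by
    intro n
    induction n with
    | zero => intro j _ hn; rw [show j = z from Fin.ext hn.symm]
    | succ n ih =>
      intro j hj hn
      cases j using Fin.lastCases with
      | last => have := z.2; simp at hn; omega
      | cast j =>
        simp only [Fin.val_castSucc] at hn
        rw [← ih j.succ (by simp [Fin.le_def]; omega) (by simp; omega), ← φ_up_succ]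
        refine hφ _ ?_ ?_ <;> rw [φ_up_succ]
        · intro e; have := congrArg Fin.val (S.up_injective e); simp at this; omega
        · exact S.up_ne_lo _ _
  have hupL' : ∀ j ≤ z, h (S.up j) = h (S.up z) := fun j hj =>
    hupL (z.1 - j.1) j hj (by rw [Fin.le_def] at hj; omega)
  have harcL : ∀ x ∈ S.leftArc, h x = h (S.up z) := by
    refine S.D.faceArc_induction (hupL' 0 (Fin.zero_le _)) fun x hx hxh hφx => ?_
    rw [← hxh]
    refine hφc x (S.not_isCorner_φ_of_mem_leftArc hx ?_)
    obtain ⟨n, hn, hn'⟩ := hφx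
    exact hn ▸ hn' n le_rfl
  have hloL : ∀ j < z, h (S.lo j) = h (S.up z) := by
    intro j
    induction j using Fin.induction with
    | zero =>
      intro hj
      obtain ⟨x, hx, hxe⟩ := S.exists_leftArc_end
      rw [← harcL x hx, ← hxe]
      refine hφ x ?_ ?_ <;> rw [hxe]
      · exact (S.up_ne_lo _ _).symm
      · intro e; exact hj.ne (S.lo_injective e)
    | succ j ih =>
      intro hj
      rw [← ih ((Fin.castSucc_lt_succ).trans hj), ← φ_lo_castSucc]
      refine hφ _ ?_ ?_ <;> rw [φ_lo_castSucc]
      · exact (S.up_ne_lo _ _).symm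
      · intro e; exact hj.ne (S.lo_injective e)
  have hL : ∀ x ∈ S.outerLeft z, h x = h (S.up z) := by
    rintro x (⟨j, hj, rfl⟩ | ⟨j, hj, rfl⟩ | hx)
    · exact hupL' _ hj
    · exact hloL _ (Fin.castSucc_lt_succ.trans_le hj)
    · exact harcL x hx
  have hloR : ∀ j, z ≤ j → h (S.lo j) = h (S.lo z) := by
    intro j
    induction j using Fin.induction with
    | zero => intro hj; rw [Fin.le_zero_iff.1 hj]
    | succ j ih =>
      intro hj
      rcases hj.eq_or_lt with rfl | hj
      · rfl
      rw [← ih (Fin.le_castSucc_iff.2 hj), ← φ_lo_castSucc]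
      refine hφ _ ?_ ?_ <;> rw [φ_lo_castSucc]
      · exact (S.up_ne_lo _ _).symm
      · intro e; exact hj.ne' (S.lo_injective e)
  have harcR : ∀ x ∈ S.rightArc, h x = h (S.lo z) := by
    refine S.D.faceArc_induction (hloR _ (Fin.le_last _)) fun x hx hxh hφx => ?_
    rw [← hxh]
    refine hφc x (S.not_isCorner_φ_of_mem_rightArc hx ?_)
    obtain ⟨n, hn, hn'⟩ := hφx
    exact hn ▸ hn' n le_rfl
  have hupR : ∀ n : ℕ, ∀ j : Fin (S.P.length + 1), z < j → S.P.length = j.1 + n →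
      h (S.up j) = h (S.lo z) := by
    intro n
    induction n with
    | zero =>
      intro j hj hn
      obtain rfl : j = Fin.last _ := Fin.ext hn.symm
      obtain ⟨x, hx, hxe⟩ := S.exists_rightArc_end
      rw [← harcR x hx, ← hxe]
      refine hφ x ?_ ?_ <;> rw [hxe]
      · intro e; exact hj.ne' (S.up_injective e)
      · exact S.up_ne_lo _ _
    | succ n ih =>
      intro j hj hn
      cases j using Fin.lastCases with
      | last => simp at hn
      | cast j =>
        simp only [Fin.val_castSucc] at hn
        rw [← ih j.succ (hj.trans Fin.castSucc_lt_succ) (by simp; omega), ← φ_up_succ]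
        refine hφ _ ?_ ?_ <;> rw [φ_up_succ]
        · intro e; exact hj.ne' (S.up_injective e)
        · exact S.up_ne_lo _ _
  have hR : ∀ x ∈ S.outerRight z, h x = h (S.lo z) := by
    rintro x (⟨j, hj, rfl⟩ | ⟨j, hj, rfl⟩ | hx)
    · exact hupR (S.P.length - (j.1 + 1)) _ (hj.trans_lt Fin.castSucc_lt_succ) (by
        have := j.2; rw [Fin.val_succ]; omega)
    · exact hloR _ hj
    · exact harcR x hx
  -- The predecessor of `up z` on the outer walk has the other value, so it cannot lie in `outerLeft
  -- z`.
  have hne : h (S.lo z) ≠ h (S.up z) := by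
    obtain ⟨x, hx⟩ := S.D.φ.surjective (S.up z)
    have h1 := hz x hx
    rw [hx] at h1
    rcases S.mem_outerLeft_or_mem_outerRight z (x := x)
      (by rw [← S.D.face_φ, hx, face_up]) with h2 | h2
    · exact absurd (hL x h2).symm h1
    · rw [← hR x h2]; exact h1.symm
  refine ⟨fun x => h x = h (S.up z), fun x hx => by rw [hα x hx], fun x h1 h2 => by rw [hφ x h1 h2],
    hL, fun x hx e => hne ?_⟩
  rw [← hR x hx, e]

end CutSetting

/-! ### Nested regions and slices -/

namespace CutSetting

variable {δ : Type*} [DecidableEq δ] {S : CutSetting δ} [Fintype δ]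

theorem IsLeftSide.φ_of_face_ne {z : Fin (S.P.length + 1)} {p : List S.DDart} {L : S.DDart → Prop}
    (h : S.IsLeftSide z p L) {x : S.DDart} (hx : S.D.face x ≠ S.outer) : L (S.D.φ x) = L x :=
  h.φ x (fun e => hx (by rw [← S.D.face_φ, e, face_up]))
    (fun e => hx (by rw [← S.D.face_φ, e, face_lo]))

/-- The dart `α (σ x)` precedes `x` on its face walk, where the side can change only if `x` is `up
z` or `lo z`; the tails of these are the ends of `p`. -/
theorem IsLeftSide.α_σ {z : Fin (S.P.length + 1)} {p : List S.DDart} {L : S.DDart → Prop}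
    (h : S.IsLeftSide z p L) (hp : S.D.IsPath (S.lower z) p (S.upper z)) {x : S.DDart}
    (hx : S.D.tail x ∉ S.D.support (S.lower z) p) : L (S.D.α (S.D.σ x)) = L x := by
  have := h.φ (S.D.α (S.D.σ x))
  rw [S.D.φ_α_σ] at this
  refine (this ?_ ?_).symm
  · rintro rfl; exact hx (S.D.mem_support_end hp.1)
  · rintro rfl; exact hx (S.D.mem_support_start _ _)

variable {p : Fin S.k → List S.DDart} {i j : Fin S.k} {L L' : S.DDart → Prop}

theorem edge_mem_Left_iff (hp : S.D.IsPath (S.x i) (p i) (S.y i))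
    (hL : S.IsLeftSide (S.pos i) (p i) L) (d : S.DDart) :
    S.D.edge d ∈ S.Left p i ↔ S.D.edge d ∈ S.D.edges (p i) ∨ L d := by
  rw [← EmbGraph.edge_mem_boundedEdges_iff S.dartConnected hp S.outer (S.outerLeft (S.pos i)) hL.α
    (fun _ => hL.φ_of_face_ne) hL.left
    (fun x hx hLx => (S.mem_outerLeft_or_mem_outerRight _ hx).resolve_right
      fun h => hL.right x h hLx) d, edge_image_outerLeft, Left]
  congr! 2
  ext e
  simp only [Set.mem_union]
  tauto

theorem edge_mem_Right_iff (hp : S.D.IsPath (S.x i) (p i) (S.y i))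
    (hL : S.IsLeftSide (S.pos i) (p i) L) (d : S.DDart) :
    S.D.edge d ∈ S.Right p i ↔ S.D.edge d ∈ S.D.edges (p i) ∨ ¬ L d := by
  rw [← EmbGraph.edge_mem_boundedEdges_iff S.dartConnected hp S.outer (S.outerRight (S.pos i))
    (S := fun d => ¬ L d) (fun x hx => by rw [hL.α x hx])
    (fun x hx => by rw [hL.φ_of_face_ne hx]) hL.right
    (fun x hx hLx => (S.mem_outerLeft_or_mem_outerRight _ hx).resolve_left
      fun h => hLx (hL.left x h)) d, edge_image_outerRight, Right]
  congr! 2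
  ext e
  simp only [Set.mem_union]
  tauto

theorem pos_lt_pos (h : i < j) : S.pos i < S.pos j :=
  (S.positions.orderEmbOfFin rfl).strictMono h

/-- An earlier path lies on the left of a later one. -/
theorem left_of_mem_edges (hp : S.IsPathFamily p) (hij : i < j)
    (hL : S.IsLeftSide (S.pos j) (p j) L) {d : S.DDart} (hd : S.D.edge d ∈ S.D.edges (p i))
    (hd' : S.D.edge d ∉ S.D.edges (p j)) : L d :=
  (hp.2 i j hij.ne).side (hp.1 i).1 (hp.1 j).1 hL.α (fun _ => hL.α_σ (hp.1 j).1)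
    (du := S.lo (S.pos i)) (du' := S.up (S.pos i)) rfl rfl
    (hL.left _ (S.lo_mem_outerLeft (pos_lt_pos hij)))
    (hL.left _ (S.up_mem_outerLeft (pos_lt_pos hij).le)) hd hd'

/-- A later path lies on the right of an earlier one. -/
theorem not_left_of_mem_edges (hp : S.IsPathFamily p) (hij : i < j)
    (hL : S.IsLeftSide (S.pos i) (p i) L) {d : S.DDart} (hd : S.D.edge d ∈ S.D.edges (p j))
    (hd' : S.D.edge d ∉ S.D.edges (p i)) : ¬ L d :=
  (hp.2 j i hij.ne').side (hp.1 j).1 (hp.1 i).1 (S := fun d => ¬ L d)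
    (fun x hx => by rw [hL.α x hx]) (fun x hx => by rw [hL.α_σ (hp.1 i).1 hx])
    (du := S.lo (S.pos j)) (du' := S.up (S.pos j)) rfl rfl
    (hL.right _ (S.lo_mem_outerRight (pos_lt_pos hij).le))
    (hL.right _ (S.up_mem_outerRight (pos_lt_pos hij))) hd hd'

theorem edges_subset_Left (hp : S.IsPathFamily p) (hij : i ≤ j) :
    S.D.edges (p i) ⊆ S.Left p j := by
  intro e he
  obtain ⟨d, rfl⟩ := S.D.edge_surjective e
  obtain ⟨L, hL⟩ := S.exists_isLeftSide (S.pos j) (hp.1 j).1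
  rw [edge_mem_Left_iff (hp.1 j).1 hL]
  rcases hij.eq_or_lt with rfl | hij
  · exact Or.inl he
  · exact or_iff_not_imp_left.2 (left_of_mem_edges hp hij hL he)

theorem edges_subset_Right (hp : S.IsPathFamily p) (hij : i ≤ j) :
    S.D.edges (p j) ⊆ S.Right p i := by
  intro e he
  obtain ⟨d, rfl⟩ := S.D.edge_surjective e
  obtain ⟨L, hL⟩ := S.exists_isLeftSide (S.pos i) (hp.1 i).1
  rw [edge_mem_Right_iff (hp.1 i).1 hL]
  rcases hij.eq_or_lt with rfl | hij
  · exact Or.inl he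
  · exact or_iff_not_imp_left.2 (not_left_of_mem_edges hp hij hL he)

/-- What is on the left of an earlier path is on the left of a later one. -/
theorem left_of_left (hp : S.IsPathFamily p) (hij : i < j)
    (hL : S.IsLeftSide (S.pos i) (p i) L) (hL' : S.IsLeftSide (S.pos j) (p j) L') {d : S.DDart}
    (hd : L d) : L' d := by
  have houter : ∀ x, S.D.face x = S.outer → ¬ (L x ∧ ¬ L' x) := by
    rintro x hx ⟨h1, h2⟩
    rcases S.mem_outerLeft_or_mem_outerRight (S.pos j) hx with h | h
    · exact h2 (hL'.left x h)
    · exact hL.right x (S.outerRight_anti (pos_lt_pos hij).le h) h1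
  -- This predicate can change only across `p i`: at an edge of `p j` off `p i` it is false on both
  -- sides, because `p j` lies on the right of `p i`. Hence it is constant, and it is false on the
  -- outer face.
  have := S.dartConnected.eq_of_isPath (hp.1 i).1 (g := fun x => L x ∧ ¬ L' x)
    (fun x => by
      by_cases hx : S.D.face x = S.outer
      · exact propext (iff_of_false (houter _ (by rwa [S.D.face_φ])) (houter _ hx))
      · rw [hL.φ_of_face_ne hx, hL'.φ_of_face_ne hx])
    (fun x hx => by
      by_cases hx' : S.D.edge x ∈ S.D.edges (p j)
      · have h1 := not_left_of_mem_edges hp hij hL hx' hx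
        rw [hL.α x hx]
        simp only [h1, false_and]
      · rw [hL.α x hx, hL'.α x hx'])
    d (S.up 0)
  by_contra h
  exact houter _ (S.face_up 0) (this.mp ⟨hd, h⟩)

theorem Left_mono (hp : S.IsPathFamily p) (hij : i ≤ j) : S.Left p i ⊆ S.Left p j := by
  rcases hij.eq_or_lt with rfl | hlt
  · exact subset_rfl
  intro e he
  obtain ⟨d, rfl⟩ := S.D.edge_surjective e
  obtain ⟨L, hL⟩ := S.exists_isLeftSide (S.pos i) (hp.1 i).1
  obtain ⟨L', hL'⟩ := S.exists_isLeftSide (S.pos j) (hp.1 j).1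
  rcases (edge_mem_Left_iff (hp.1 i).1 hL d).1 he with he | he
  · exact edges_subset_Left hp hij he
  · exact (edge_mem_Left_iff (hp.1 j).1 hL' d).2 (Or.inr (left_of_left hp hlt hL hL' he))

theorem Right_anti (hp : S.IsPathFamily p) (hij : i ≤ j) : S.Right p j ⊆ S.Right p i := by
  rcases hij.eq_or_lt with rfl | hlt
  · exact subset_rfl
  intro e he
  obtain ⟨d, rfl⟩ := S.D.edge_surjective e
  obtain ⟨L, hL⟩ := S.exists_isLeftSide (S.pos i) (hp.1 i).1
  obtain ⟨L', hL'⟩ := S.exists_isLeftSide (S.pos j) (hp.1 j).1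
  rcases (edge_mem_Right_iff (hp.1 j).1 hL' d).1 he with he | he
  · exact edges_subset_Right hp hij he
  · exact (edge_mem_Right_iff (hp.1 i).1 hL d).2
      (Or.inr fun h => he (left_of_left hp hlt hL hL' h))

theorem mem_edges_of_mem_Left_of_mem_Right (hp : S.IsPathFamily p) {e : S.D.Edge}
    (hl : e ∈ S.Left p i) (hr : e ∈ S.Right p i) : e ∈ S.D.edges (p i) := by
  obtain ⟨d, rfl⟩ := S.D.edge_surjective e
  obtain ⟨L, hL⟩ := S.exists_isLeftSide (S.pos i) (hp.1 i).1
  rw [edge_mem_Left_iff (hp.1 i).1 hL] at hl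
  rw [edge_mem_Right_iff (hp.1 i).1 hL] at hr
  tauto

/-- Only the bounds facing each other, `Left` at `i + 1` and `Right` at `j - 1`, are needed
forwards. Backwards, membership in the paths `i + 1` and `j - 1` suffices; these coincide if `j = i
+ 2`. -/
theorem mem_Slice_inter_Slice_iff (hp : S.IsPathFamily p) (hij : i.val + 2 ≤ j.val) (e : S.D.Edge) :
    e ∈ S.Slice p i ∩ S.Slice p j ↔ ∀ z : Fin S.k, i < z → z < j → e ∈ S.D.edges (p z) := by
  constructor
  · rintro ⟨⟨-, hi⟩, hj, -⟩ z hiz hzj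
    rw [Fin.lt_def] at hiz hzj
    have h1 := hi ⟨i.1 + 1, by omega⟩ rfl
    have h2 := hj ⟨j.1 - 1, by omega⟩ (by simp; omega)
    exact mem_edges_of_mem_Left_of_mem_Right hp
      (Left_mono hp (by rw [Fin.le_def]; simp; omega) h1)
      (Right_anti hp (by rw [Fin.le_def]; simp; omega) h2)
  · intro h
    have h1 := h ⟨i.1 + 1, by omega⟩ (by simp [Fin.lt_def]) (by rw [Fin.lt_def]; simp; omega)
    have h2 := h ⟨j.1 - 1, by omega⟩ (by rw [Fin.lt_def]; simp; omega)
      (by rw [Fin.lt_def]; simp; omega)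
    refine ⟨⟨fun z hz => ?_, fun z hz => ?_⟩, fun z hz => ?_, fun z hz => ?_⟩
    · exact edges_subset_Right hp (by rw [Fin.le_def]; simp; omega) h1
    · exact edges_subset_Left hp (by rw [Fin.le_def]; simp; omega) h1
    · exact edges_subset_Right hp (by rw [Fin.le_def]; simp; omega) h2
    · exact edges_subset_Left hp (by rw [Fin.le_def]; simp; omega) h2

end CutSetting

theorem mainTheorem7 {δ : Type*} [Fintype δ] [DecidableEq δ] (S : CutSetting δ)
    (p : Fin S.k → List S.DDart) (hp : S.IsPathFamily p) :
    (∀ i j : Fin S.k, i.val + 2 ≤ j.val → ∀ e : S.D.Edge,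
      (e ∈ S.Slice p i ∩ S.Slice p j ↔ ∀ z : Fin S.k, i < z → z < j → e ∈ S.D.edges (p z))) ∧
    ∀ e : S.D.Edge, 2 < Set.ncard {i : Fin S.k | e ∈ S.Slice p i} → e ∈ S.U p := by
  refine ⟨fun i j hij e => CutSetting.mem_Slice_inter_Slice_iff hp hij e, fun e he => ?_⟩
  have key : ∀ i j : Fin S.k, e ∈ S.Slice p i → e ∈ S.Slice p j → i.val + 2 ≤ j.val →
      e ∈ S.U p := fun i j hi hj hij =>
    Set.mem_iUnion.2 ⟨⟨i.1 + 1, by omega⟩, (CutSetting.mem_Slice_inter_Slice_iff hp hij e).1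
      ⟨hi, hj⟩ _ (by simp [Fin.lt_def]) (by rw [Fin.lt_def]; simp; omega)⟩
  obtain ⟨a, b, c, ha, hb, hc, hab, hac, hbc⟩ := (Set.two_lt_ncard_iff (Set.toFinite _)).1 he
  simp only [Set.mem_ofPred_eq] at ha hb hc
  rw [ne_eq, Fin.ext_iff] at hab hac hbc
  -- Three distinct integers cannot be pairwise within distance one.
  have : a.1 + 2 ≤ b.1 ∨ b.1 + 2 ≤ a.1 ∨ a.1 + 2 ≤ c.1 ∨ c.1 + 2 ≤ a.1 ∨ b.1 + 2 ≤ c.1 ∨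
      c.1 + 2 ≤ b.1 := by omega
  rcases this with h | h | h | h | h | h
  · exact key a b ha hb h
  · exact key b a hb ha h
  · exact key a c ha hc h
  · exact key c a hc ha h
  · exact key b c hb hc h
  · exact key c b hc hb h
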